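/- Let $G$ be a finite simple undirected graph with vertex set $\mathsf V$ and non-empty edge set $\mathsf E$. Each edge $\mathsf e$ has a length $\ell_{\mathsf e}\in(0,\infty)$ and is identified with $[0,\ell_{\mathsf e}]$; $\mathsf E_{\mathsf v}$ denotes the set of edges incident to $\mathsf v\in\mathsf V$. Let $c_{\mathsf e}\in C[0,\ell_{\mathsf e}]$ and $p_{\mathsf e}\in L^\infty(0,\ell_{\mathsf e})$ be real-valued functions such that, for some constant $c_0>0$ and all $\mathsf e\in\mathsf E$, $c_{\mathsf e}(x)\ge c_0$ and $p_{\mathsf e}(x)\ge 0$ for almost all $x\in(0,\ell_{\mathsf e})$. On the real Hilbert space $\mathcal H=\prod_{\mathsf e\in\mathsf E}L^2(0,\ell_{\mathsf e})$ let $A$ be the operator $$Au=\big((c_{\mathsf e}u_{\mathsf e}')'-p_{\mathsf e}u_{\mathsf e}\big)_{\mathsf e\in\mathsf E},$$ whose domain $D(A)$ consists of all $u=(u_{\mathsf e})_{\mathsf e\in\mathsf E}$ such that $u_{\mathsf e}\in H^1(0,\ell_{\mathsf e})$ and $c_{\mathsf e}u_{\mathsf e}'\in H^1(0,\ell_{\mathsf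 e})$ for every $\mathsf e$, and such that at every vertex $\mathsf v$ the values $u_{\mathsf e}(\mathsf v)$, $\mathsf e\in\mathsf E_{\mathsf v}$, coincide and $\sum_{\mathsf e\in\mathsf E_{\mathsf v}}c_{\mathsf e}(\mathsf v)\,u_{\mathsf e}'(\mathsf v)=0$, where $u_{\mathsf e}'(\mathsf v)$ is the derivative at $\mathsf v$ in the direction from $\mathsf v$ into the edge $\mathsf e$. (If the $c_{\mathsf e}$ are continuously differentiable, the two edge conditions together say $u_{\mathsf e}\in H^2(0,\ell_{\mathsf e})$.) Then there exist a non-increasing real sequence $(\lambda_k)_{k\ge 1}$ and a complete orthonormal system $(f_k)_{k\ge 1}$ of $\mathcal H$ with $f_k\in D(A)$ and $Af_k=\lambda_kf_k$ for all $k\ge 1$; that is, $(\lambda_k)$ is the sequence of eigenvalues of $A$ repeated according to multiplicity. Moreover, for every such sequence $(\lambda_k)$ and every $\lambda>0$ there exist constants $l_1,l_2>0$ such that $$l_1k^2\le\lambda-\lambda_k\le l_2k^2\qquad\text{for all }k\ge 1.$$ -/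

import Mathlib

open MeasureTheory Set

/-- A compact metric graph carried by the simple graph `G`: every edge `e` has a positive finite
length `ℓ_e` and is identified with the interval `[0, ℓ_e]`, the coordinate `0` being the end point
`src e` and the coordinate `ℓ_e` being the end point `tgt e`. -/
structure MetricGraph {V : Type*} (G : SimpleGraph V) where
  src : G.edgeSet → V
  tgt : G.edgeSet → V
  ends : ∀ e : G.edgeSet, s(src e, tgt e) = (e : Sym2 V)
  length : G.edgeSet → ℝ
  length_pos : ∀ e, 0 < length e

/-- `u` is (the continuous representative of) an element of the Sobolev space `H¹(0, ℓ)` with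
derivative `u'`: it is absolutely continuous on `[0, ℓ]` with square integrable derivative `u'`. -/
def IsH1 (l : ℝ) (u u' : ℝ → ℝ) : Prop :=
  MemLp u' 2 (volume.restrict (Ioo 0 l)) ∧
    ∀ x ∈ Icc 0 l, u x = u 0 + ∫ t in (0 : ℝ)..x, u' t

theorem IsH1.intervalIntegrable {l : ℝ} {u u' : ℝ → ℝ} (h : IsH1 l u u') {x : ℝ}
    (hx : x ∈ Icc 0 l) : IntervalIntegrable u' volume 0 x := by
  rw [intervalIntegrable_iff_integrableOn_Ioo_of_le hx.1]
  have h1 : IntegrableOn u' (Ioo 0 l) := h.1.integrable (by norm_num)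
  exact h1.mono_set (Ioo_subset_Ioo_right hx.2)

theorem IsH1.zero (l : ℝ) : IsH1 l 0 0 := by
  refine ⟨MemLp.zero, fun x _ => ?_⟩
  simp

theorem IsH1.add {l : ℝ} {u u' v v' : ℝ → ℝ} (hu : IsH1 l u u') (hv : IsH1 l v v') :
    IsH1 l (u + v) (u' + v') := by
  refine ⟨hu.1.add hv.1, fun x hx => ?_⟩
  have h := intervalIntegral.integral_add (hu.intervalIntegrable hx) (hv.intervalIntegrable hx)
  simp only [Pi.add_apply]
  rw [h, hu.2 x hx, hv.2 x hx]
  ring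

theorem IsH1.smul {l : ℝ} {u u' : ℝ → ℝ} (a : ℝ) (hu : IsH1 l u u') :
    IsH1 l (a • u) (a • u') := by
  refine ⟨hu.1.const_smul a, fun x hx => ?_⟩
  simp only [Pi.smul_apply, smul_eq_mul, intervalIntegral.integral_const_mul]
  rw [hu.2 x hx]
  ring

theorem IsH1.continuousOn {l : ℝ} {u u' : ℝ → ℝ} (hu : IsH1 l u u') :
    ContinuousOn u (Icc 0 l) := by
  rcases lt_or_ge l 0 with hl | hl
  · rw [Icc_eq_empty (not_le.mpr hl)]
    exact continuousOn_empty _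
  · have h1 : IntegrableOn u' (uIcc 0 l) := by
      rw [uIcc_of_le hl, integrableOn_Icc_iff_integrableOn_Ioo]
      exact hu.1.integrable (by norm_num)
    have h2 := intervalIntegral.continuousOn_primitive_interval h1
    rw [uIcc_of_le hl] at h2
    exact (continuousOn_const.add h2).congr hu.2

theorem IsH1.ae_hasDerivAt {l : ℝ} (hl : 0 < l) {u u' : ℝ → ℝ} (hu : IsH1 l u u') :
    ∀ᵐ x ∂(volume.restrict (Ioo 0 l)), HasDerivAt u (u' x) x := by
  have h1 := (hu.intervalIntegrable (right_mem_Icc.mpr hl.le)).ae_hasDerivAt_integral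
  filter_upwards [ae_restrict_of_ae h1, ae_restrict_mem measurableSet_Ioo] with x hx hm
  have hx' := (hx (by rw [uIcc_of_le hl.le]; exact Ioo_subset_Icc_self hm) 0
    left_mem_uIcc).const_add (u 0)
  refine hx'.congr_of_eventuallyEq ?_
  filter_upwards [isOpen_Ioo.mem_nhds hm] with y hy
  exact hu.2 y (Ioo_subset_Icc_self hy)

/-- The derivative of an `H¹` function is determined by the function, almost everywhere. -/
theorem IsH1.derivative_unique {l : ℝ} (hl : 0 < l) {u u' v v' : ℝ → ℝ} (hu : IsH1 l u u')
    (hv : IsH1 l v v') (h : u =ᵐ[volume.restrict (Ioo 0 l)] v) :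
    u' =ᵐ[volume.restrict (Ioo 0 l)] v' := by
  have hEq : EqOn u v (Ioo 0 l) :=
    Measure.eqOn_open_of_ae_eq h isOpen_Ioo (hu.continuousOn.mono Ioo_subset_Icc_self)
      (hv.continuousOn.mono Ioo_subset_Icc_self)
  filter_upwards [hu.ae_hasDerivAt hl, hv.ae_hasDerivAt hl, ae_restrict_mem measurableSet_Ioo]
    with x h1 h2 hm
  refine h1.unique (h2.congr_of_eventuallyEq ?_)
  filter_upwards [isOpen_Ioo.mem_nhds hm] with y hy
  exact hEq hy

namespace MetricGraph

variable {V : Type*} {G : SimpleGraph V}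

/-- The coordinate on the edge `e` of its end point `v`. -/
noncomputable def coord (Γ : MetricGraph G) (e : G.edgeSet) (v : V) : ℝ :=
  open Classical in if v = Γ.src e then 0 else Γ.length e

/-- The derivative at the end point `v` of the edge `e`, taken in the direction away from `v`
(into the edge), of a function on `[0, ℓ_e]` with derivative `u'`. -/
noncomputable def outwardDeriv (Γ : MetricGraph G) (e : G.edgeSet) (v : V) (u' : ℝ → ℝ) : ℝ :=
  open Classical in if v = Γ.src e then u' 0 else -u' (Γ.length e)

/-- Continuity at the vertices: at every vertex the values along all incident edges coincide. -/
def VertexContinuous (Γ : MetricGraph G) (u : G.edgeSet → ℝ → ℝ) : Prop :=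
  ∀ (v : V) (e₁ e₂ : G.edgeSet), v ∈ (e₁ : Sym2 V) → v ∈ (e₂ : Sym2 V) →
    u e₁ (Γ.coord e₁ v) = u e₂ (Γ.coord e₂ v)

variable [Fintype G.edgeSet]

/-- The Kirchhoff condition: at every vertex `v`, the sum of `c_e(v) u_e'(v)` over the edges `e`
incident to `v` vanishes. -/
def Kirchhoff (Γ : MetricGraph G) (c u' : G.edgeSet → ℝ → ℝ) : Prop :=
  open Classical in
  ∀ v : V, ∑ e ∈ Finset.univ.filter (fun e : G.edgeSet => v ∈ (e : Sym2 V)),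
    c e (Γ.coord e v) * Γ.outwardDeriv e v (u' e) = 0

/-- The state space: the Hilbert space product of the spaces `L²(0, ℓ_e)`. -/
abbrev StateSpace (Γ : MetricGraph G) : Type _ :=
  PiLp 2 fun e : G.edgeSet => Lp ℝ 2 (volume.restrict (Ioo (0 : ℝ) (Γ.length e)))

/-- The relation "`f` belongs to the domain of `A` and `A f = h`", where `A` acts as
`(c_e u')' - p_e u` on each edge. The function `u` is the continuous representative of `f`, `u'` its
derivative, `w = c u'` the flux, which is again `H¹` on each edge, and `w'` the derivative of the
flux. -/
def OperatorRel (Γ : MetricGraph G) (c p : G.edgeSet → ℝ → ℝ) (f h : Γ.StateSpace) : Prop :=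
  ∃ u u' w w' : G.edgeSet → ℝ → ℝ,
    (∀ e, f e =ᵐ[volume.restrict (Ioo 0 (Γ.length e))] u e) ∧
    (∀ e, IsH1 (Γ.length e) (u e) (u' e)) ∧
    (∀ e, IsH1 (Γ.length e) (w e) (w' e)) ∧
    (∀ e, ∀ x ∈ Icc 0 (Γ.length e), w e x = c e x * u' e x) ∧
    Γ.VertexContinuous u ∧
    Γ.Kirchhoff c u' ∧
    (∀ e, h e =ᵐ[volume.restrict (Ioo 0 (Γ.length e))] fun x => w' e x - p e x * u e x)

/-- The graph of the operator `A`. -/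
def operatorGraph (Γ : MetricGraph G) (c p : G.edgeSet → ℝ → ℝ) :
    Submodule ℝ (Γ.StateSpace × Γ.StateSpace) where
  carrier := {q | Γ.OperatorRel c p q.1 q.2}
  zero_mem' := by
    refine ⟨0, 0, 0, 0, fun e => ?_, fun e => IsH1.zero _, fun e => IsH1.zero _, ?_, ?_, ?_,
      fun e => ?_⟩
    · exact Lp.coeFn_zero _ _ _
    · simp
    · intro v e₁ e₂ _ _
      simp
    · intro v
      simp [outwardDeriv]
    · filter_upwards [Lp.coeFn_zero ℝ 2 (volume.restrict (Ioo (0 : ℝ) (Γ.length e)))] with x hx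
      simpa using hx
  add_mem' := by
    rintro ⟨f₁, h₁⟩ ⟨f₂, h₂⟩ ⟨u₁, u₁', w₁, w₁', a₁, b₁, c₁, d₁, i₁, j₁, k₁⟩
      ⟨u₂, u₂', w₂, w₂', a₂, b₂, c₂, d₂, i₂, j₂, k₂⟩
    refine ⟨u₁ + u₂, u₁' + u₂', w₁ + w₂, w₁' + w₂', fun e => ?_, fun e => (b₁ e).add (b₂ e),
      fun e => (c₁ e).add (c₂ e), fun e x hx => ?_, fun v e₁ e₂ m₁ m₂ => ?_, fun v => ?_,
      fun e => ?_⟩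
    · filter_upwards [Lp.coeFn_add (f₁ e) (f₂ e), a₁ e, a₂ e] with x hx y z
      simp only [PiLp.add_apply, Prod.mk_add_mk, Pi.add_apply, hx, y, z]
    · simp only [Pi.add_apply, d₁ e x hx, d₂ e x hx]
      ring
    · simp only [Pi.add_apply, i₁ v e₁ e₂ m₁ m₂, i₂ v e₁ e₂ m₁ m₂]
    · have s := congrArg₂ (· + ·) (j₁ v) (j₂ v)
      simp only [← Finset.sum_add_distrib, add_zero] at s
      rw [← s]
      refine Finset.sum_congr rfl fun e _ => ?_
      unfold outwardDeriv
      split_ifs <;> simp only [Pi.add_apply] <;> ring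
    · filter_upwards [Lp.coeFn_add (h₁ e) (h₂ e), k₁ e, k₂ e] with x hx y z
      simp only [PiLp.add_apply, Prod.mk_add_mk, Pi.add_apply, hx, y, z]
      ring
  smul_mem' := by
    rintro r ⟨f, h⟩ ⟨u, u', w, w', a₁, b₁, c₁, d₁, i₁, j₁, k₁⟩
    refine ⟨r • u, r • u', r • w, r • w', fun e => ?_, fun e => (b₁ e).smul r,
      fun e => (c₁ e).smul r, fun e x hx => ?_, fun v e₁ e₂ m₁ m₂ => ?_, fun v => ?_,
      fun e => ?_⟩
    · filter_upwards [Lp.coeFn_smul r (f e), a₁ e] with x hx y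
      simp only [PiLp.smul_apply, Prod.smul_mk, Pi.smul_apply, hx, y]
    · simp only [Pi.smul_apply, smul_eq_mul, d₁ e x hx]
      ring
    · simp only [Pi.smul_apply, i₁ v e₁ e₂ m₁ m₂]
    · have s := congrArg (r * ·) (j₁ v)
      simp only [Finset.mul_sum, mul_zero] at s
      rw [← s]
      refine Finset.sum_congr rfl fun e _ => ?_
      unfold outwardDeriv
      split_ifs <;> simp only [Pi.smul_apply, smul_eq_mul] <;> ring
    · filter_upwards [Lp.coeFn_smul r (h e), k₁ e] with x hx y
      simp only [PiLp.smul_apply, Prod.smul_mk, Pi.smul_apply, hx, y, smul_eq_mul]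
      ring

theorem operatorRel_unique (Γ : MetricGraph G) (c p : G.edgeSet → ℝ → ℝ) {f h₁ h₂ : Γ.StateSpace}
    (H₁ : Γ.OperatorRel c p f h₁) (H₂ : Γ.OperatorRel c p f h₂) : h₁ = h₂ := by
  obtain ⟨u₁, u₁', w₁, w₁', a₁, b₁, c₁, d₁, -, -, k₁⟩ := H₁
  obtain ⟨u₂, u₂', w₂, w₂', a₂, b₂, c₂, d₂, -, -, k₂⟩ := H₂
  ext1 e
  refine Lp.ext ?_
  have hu := (a₁ e).symm.trans (a₂ e)
  have hu' := (b₁ e).derivative_unique (Γ.length_pos e) (b₂ e) hu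
  have hw : w₁ e =ᵐ[volume.restrict (Ioo 0 (Γ.length e))] w₂ e := by
    filter_upwards [hu', ae_restrict_mem measurableSet_Ioo] with x hx hm
    rw [d₁ e x (Ioo_subset_Icc_self hm), d₂ e x (Ioo_subset_Icc_self hm), hx]
  filter_upwards [k₁ e, k₂ e, hu, (c₁ e).derivative_unique (Γ.length_pos e) (c₂ e) hw] with x p₁ p₂ p₃ p₄
  rw [p₁, p₂, p₃, p₄]

/-- The operator `A`: it acts as `(c_e u')' - p_e u` on each edge, and its domain consists of the
functions `u` that are `H¹` with `c u'` in `H¹` on each edge, continuous at the vertices, and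
satisfy the Kirchhoff condition at each vertex. -/
noncomputable def operator (Γ : MetricGraph G) (c p : G.edgeSet → ℝ → ℝ) :
    Γ.StateSpace →ₗ.[ℝ] Γ.StateSpace :=
  (Γ.operatorGraph c p).toLinearPMap

theorem mem_operator_graph_iff (Γ : MetricGraph G) (c p : G.edgeSet → ℝ → ℝ)
    (f h : Γ.StateSpace) : (f, h) ∈ (Γ.operator c p).graph ↔ Γ.OperatorRel c p f h := by
  unfold operator
  rw [Submodule.toLinearPMap_graph_eq]
  · rfl
  · rintro ⟨x, y⟩ hx (rfl : x = 0)
    exact Γ.operatorRel_unique c p hx (Γ.operatorGraph c p).zero_mem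

/-- `eig 0 ≥ eig 1 ≥ …` is the sequence of eigenvalues of `A`, repeated according to multiplicity:
there is a complete orthonormal system of eigenfunctions `f k` with `A (f k) = eig k • f k`. -/
def IsEigenvalueSequence (Γ : MetricGraph G) (c p : G.edgeSet → ℝ → ℝ) (eig : ℕ → ℝ) : Prop :=
  Antitone eig ∧
    ∃ f : HilbertBasis ℕ ℝ Γ.StateSpace, ∀ k : ℕ,
      ∃ hk : f k ∈ (Γ.operator c p).domain, Γ.operator c p ⟨f k, hk⟩ = eig k • f k

end MetricGraph

/-! The operator -A belongs to the form a(u, v) = ∑ₑ ∫ (c u' v' + p u v) on the H¹ functions that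
are continuous at the vertices. The Kirchhoff condition is the natural boundary condition of this
form: Green's formula and the du Bois-Reymond lemma show that the weak and the strong description of
A agree (`exists_form_of_operatorRel`, `operatorRel_of_form`). An H¹ function on an edge is its
initial value together with an L² derivative, so the form domain is a closed subspace of the Hilbert
space `FormSpace`. It embeds compactly in the state space; hence (1 - A)⁻¹ is compact, symmetric,
positive and injective, and its eigenbasis is one for A (`exists_weak_eigenbasis`).

Both bounds are min-max arguments. Let m be the number of edges. Vanishing at n equidistant points
of every edge amounts to mn linear conditions, and under them the Poincaré inequality on cells of
length ℓₑ/n gives n²‖u‖² ≤ const · a(u, u) (`exists_vanishing_functional`). More than mn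
eigenfunctions have a nonzero combination u satisfying these conditions, so -λₖ ≥ const · n² as soon
as k exceeds mn.

In the other direction, the first n sine modes of a single edge, extended by zero, vanish at all
vertices, lie in the form domain and satisfy a(u, u) ≤ const · n²‖u‖² (`exists_test_space`). Some
nonzero u in their span is orthogonal to the first n - 1 eigenfunctions, whence -λₙ ≤ const · n².

The shift λ > 0 is needed only for the first few k, where λₖ may be 0 (constants, if p = 0). -/

/-! ### Compact positive operators on a Hilbert space -/

section CompactSelfAdjoint

variable {H : Type*} [NormedAddCommGroup H] [InnerProductSpace ℝ H] [CompleteSpace H]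

/-- A nonzero compact positive operator attains its norm at a unit eigenvector. -/
theorem exists_unit_eigenvector_of_compact_pos {T : H →L[ℝ] H} (hc : IsCompactOperator T)
    (hs : (T : H →ₗ[ℝ] H).IsSymmetric) (hpos : ∀ x, 0 ≤ inner ℝ (T x) x) (h0 : T ≠ 0) :
    ∃ v : H, ‖v‖ = 1 ∧ T v = ‖T‖ • v := by
  have hn : 0 < ‖T‖ := norm_pos_iff.mpr h0
  have : Nontrivial H := by
    by_contra hH
    rw [not_nontrivial_iff_subsingleton] at hH
    exact h0 (ContinuousLinearMap.ext fun x => Subsingleton.elim _ _)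
  -- Were `‖T‖` in the resolvent set, all Rayleigh quotients would stay below `‖T‖ - ε`; but for a
  -- positive symmetric operator their supremum is `‖T‖`.
  have hspec : ‖T‖ ∈ spectrum ℝ T := by
    intro hres
    obtain ⟨ε, hε, h⟩ := T.rayleighQuotient_le_of_norm_mem_resolventSet (𝕜 := ℝ) hres
    have h1 : ‖T‖ ≤ ‖T‖ - ε := by
      conv_lhs => rw [T.norm_eq_iSup_rayleighQuotient hs]
      refine ciSup_le fun x => ?_
      rw [abs_of_nonneg]
      · exact h x
      · exact div_nonneg (hpos x) (sq_nonneg _)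
    linarith
  rw [← hc.hasEigenvalue_iff_mem_spectrum hn.ne'] at hspec
  obtain ⟨v, hv⟩ := hspec.exists_hasEigenvector
  have hv0 : ‖v‖ ≠ 0 := norm_ne_zero_iff.mpr hv.2
  refine ⟨‖v‖⁻¹ • v, by simp [norm_smul, hv0], ?_⟩
  have hv1 : T v = ‖T‖ • v := hv.apply_eq_smul
  rw [map_smul, hv1, smul_comm]

/-- One step in the construction of the eigenbasis: an eigenvector in the orthogonal complement
of a finite-dimensional invariant subspace. -/
theorem exists_eigenvector_orthogonal {R : H →L[ℝ] H} (hinf : ¬ FiniteDimensional ℝ H)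
    (hc : IsCompactOperator R) (hs : (R : H →ₗ[ℝ] H).IsSymmetric)
    (hpos : ∀ x, 0 ≤ inner ℝ (R x) x) (hinj : ∀ x, R x = 0 → x = 0)
    (F : Submodule ℝ H) (hF : FiniteDimensional ℝ F) (hFR : ∀ x ∈ F, R x ∈ F) :
    ∃ v ∈ Fᗮ, ∃ m : ℝ, ‖v‖ = 1 ∧ 0 < m ∧ R v = m • v ∧ ∀ w ∈ Fᗮ, ‖R w‖ ≤ m * ‖w‖ := by
  have hFo : ∀ x ∈ Fᗮ, R x ∈ Fᗮ := by
    intro x hx y hy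
    have := hs y x
    simp only [ContinuousLinearMap.coe_coe] at this
    rw [← this]
    exact hx _ (hFR y hy)
  let S : Fᗮ →L[ℝ] Fᗮ := R.restrict hFo
  have hS : ∀ x : Fᗮ, ((S x : Fᗮ) : H) = R x := fun x => rfl
  have hSc : IsCompactOperator S := hc.restrict' hFo
  have hSs : (S : Fᗮ →ₗ[ℝ] Fᗮ).IsSymmetric := hs.restrict_invariant hFo
  have hne : Fᗮ ≠ ⊥ := by
    intro h
    rw [Submodule.orthogonal_eq_bot_iff] at h
    subst h
    exact hinf (Submodule.topEquiv.finiteDimensional)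
  obtain ⟨z, hz, hz0⟩ := Submodule.exists_mem_ne_zero_of_ne_bot hne
  have hS0 : S ≠ 0 := by
    intro h
    apply hz0
    apply hinj
    have := hS ⟨z, hz⟩
    rw [h] at this
    simpa using this.symm
  obtain ⟨v, hv1, hv2⟩ := exists_unit_eigenvector_of_compact_pos hSc hSs
    (fun x => hpos x) hS0
  refine ⟨v, v.2, ‖S‖, by simpa using hv1, (norm_nonneg S).lt_of_ne' ?_, ?_, fun w hw => ?_⟩
  · exact fun h => hS0 ((ContinuousLinearMap.opNorm_zero_iff (f := S)).mp h)
  · rw [← hS, hv2]; rfl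
  · exact S.le_opNorm ⟨w, hw⟩

/-- The spectral theorem for injective positive compact operators on an infinite-dimensional
Hilbert space, with the eigenvalues in decreasing order. -/
theorem exists_hilbertBasis_of_compact_pos {R : H →L[ℝ] H} (hinf : ¬ FiniteDimensional ℝ H)
    (hc : IsCompactOperator R) (hs : (R : H →ₗ[ℝ] H).IsSymmetric)
    (hpos : ∀ x, 0 ≤ inner ℝ (R x) x) (hinj : ∀ x, R x = 0 → x = 0) :
    ∃ (f : HilbertBasis ℕ ℝ H) (m : ℕ → ℝ), Antitone m ∧ (∀ k, 0 < m k) ∧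
      ∀ k, R (f k) = m k • f k := by
  classical
  -- The eigenvectors are chosen greedily: a state is the invariant span of those found so far, and
  -- the next one is a maximizing eigenvector in its orthogonal complement.
  let X := {F : Submodule ℝ H // FiniteDimensional ℝ F ∧ ∀ x ∈ F, R x ∈ F}
  have step : ∀ F : X, ∃ v ∈ (F.1)ᗮ, ∃ m : ℝ, ‖v‖ = 1 ∧ 0 < m ∧ R v = m • v ∧
      ∀ w ∈ (F.1)ᗮ, ‖R w‖ ≤ m * ‖w‖ := fun F =>
    exists_eigenvector_orthogonal hinf hc hs hpos hinj F.1 F.2.1 F.2.2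
  choose v hvo m hv1 hm hRv hmax using step
  let next : X → X := fun F => ⟨F.1 ⊔ Submodule.span ℝ {v F}, by
    have := F.2.1
    refine ⟨inferInstance, fun x hx => ?_⟩
    obtain ⟨y, hy, z, hz, rfl⟩ := Submodule.mem_sup.mp hx
    obtain ⟨a, rfl⟩ := Submodule.mem_span_singleton.mp hz
    rw [map_add]
    refine Submodule.add_mem_sup (F.2.2 y hy) ?_
    rw [map_smul, hRv]
    exact Submodule.smul_mem _ _ (Submodule.smul_mem _ _ (Submodule.mem_span_singleton_self _))⟩
  let F : ℕ → X := fun n => next^[n] ⟨⊥, inferInstance, by simp⟩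
  have hF : ∀ n, F (n + 1) = next (F n) := fun n => Function.iterate_succ_apply' _ _ _
  have hFmono : Monotone fun n => (F n).1 := by
    refine monotone_nat_of_le_succ fun n => ?_
    rw [hF]
    exact le_sup_left
  have hmem : ∀ i j, i < j → v (F i) ∈ (F j).1 := by
    intro i j hij
    refine hFmono (Nat.succ_le_of_lt hij) ?_
    change v (F i) ∈ (F (i + 1)).1
    rw [hF]
    exact Submodule.mem_sup_right (Submodule.mem_span_singleton_self _)
  have hon : Orthonormal ℝ fun n => v (F n) := by
    refine ⟨fun n => hv1 _, fun i j hij => ?_⟩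
    rcases lt_or_gt_of_ne hij with h | h
    · exact hvo (F j) _ (hmem i j h)
    · exact (real_inner_comm _ _).trans (hvo (F i) _ (hmem j i h))
  -- The eigenvector found at stage n + 1 is also orthogonal to `F n`, so it already competed at
  -- stage n.
  have hanti : Antitone fun n => m (F n) := by
    refine antitone_nat_of_succ_le fun n => ?_
    have h1 := hmax (F n) (v (F (n + 1)))
      (Submodule.orthogonal_le (hFmono (Nat.le_succ n)) (hvo (F (n + 1))))
    rw [hRv, norm_smul, hv1, Real.norm_eq_abs, abs_of_pos (hm _)] at h1
    simpa using h1
  -- If all eigenvalues were at least ε, the images of the orthonormal eigenvectors would be more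
  -- than ε apart, and compactness would fail.
  have hlim : ∀ ε > 0, ∃ n, m (F n) < ε := by
    intro ε hε
    by_contra! hcon
    obtain ⟨K, hK, hKs⟩ := IsCompactOperator.image_closedBall_subset_compact (f := (R : H →ₗ[ℝ] H)) hc 1
    have hin : ∀ n, R (v (F n)) ∈ K := fun n =>
      hKs ⟨v (F n), by simp [hv1], rfl⟩
    obtain ⟨a, -, φ, hφ, hlim⟩ := hK.tendsto_subseq hin
    have hcau := hlim.cauchySeq
    rw [Metric.cauchySeq_iff'] at hcau
    obtain ⟨N, hN⟩ := hcau ε hε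
    have h1 := hN (N + 1) (Nat.le_succ N)
    have hlt : φ N < φ (N + 1) := hφ (Nat.lt_succ_self N)
    have ho : inner ℝ (v (F (φ (N + 1)))) (v (F (φ N))) = 0 := hon.2 hlt.ne'
    rw [dist_eq_norm] at h1
    simp only [Function.comp_apply, hRv] at h1
    have h2 := norm_sub_sq_real (m (F (φ (N + 1))) • v (F (φ (N + 1))))
      (m (F (φ N)) • v (F (φ N)))
    rw [inner_smul_left, inner_smul_right, ho, norm_smul, norm_smul, hv1, hv1] at h2
    simp only [Real.norm_eq_abs, sq_abs, mul_one, mul_zero, sub_zero] at h2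
    have h3 := hcon (φ N)
    nlinarith [norm_nonneg (m (F (φ (N + 1))) • v (F (φ (N + 1))) - m (F (φ N)) • v (F (φ N))),
      sq_nonneg (m (F (φ (N + 1))))]
  -- A vector g orthogonal to all eigenvectors satisfies `‖R g‖ ≤ m (F n) * ‖g‖` for every n, so `R
  -- g = 0`, and R is injective.
  have hperp : (Submodule.span ℝ (Set.range fun n => v (F n)))ᗮ = ⊥ := by
    rw [Submodule.eq_bot_iff]
    intro g hg
    have hgF : ∀ n, g ∈ ((F n).1)ᗮ := by
      intro n
      have hle : (F n).1 ≤ Submodule.span ℝ (Set.range fun n => v (F n)) := by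
        induction n with
        | zero => exact bot_le
        | succ n ih =>
          rw [hF]
          refine sup_le ih (Submodule.span_mono ?_)
          rintro _ rfl
          exact ⟨n, rfl⟩
      exact Submodule.orthogonal_le hle hg
    apply hinj
    rw [← norm_eq_zero]
    refine le_antisymm (le_of_forall_pos_le_add fun ε hε => ?_) (norm_nonneg _)
    obtain ⟨n, hn⟩ := hlim (ε / (‖g‖ + 1)) (by positivity)
    have h1 := hmax (F n) g (hgF n)
    have h2 : m (F n) * ‖g‖ ≤ ε / (‖g‖ + 1) * (‖g‖ + 1) := by
      gcongr
      linarith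
    rw [div_mul_cancel₀ _ (by positivity)] at h2
    linarith
  refine ⟨HilbertBasis.mkOfOrthogonalEqBot hon hperp, fun n => m (F n), hanti, fun k => hm _,
    fun k => ?_⟩
  rw [HilbertBasis.coe_mkOfOrthogonalEqBot]
  exact hRv _

/-- An operator is compact if it is arbitrarily small on subspaces of finite codimension. -/
theorem isCompactOperator_of_small_on_finite_codim {H' : Type*} [NormedAddCommGroup H']
    [InnerProductSpace ℝ H'] [CompleteSpace H'] (J : H →L[ℝ] H')
    (h : ∀ ε > 0, ∃ (N : ℕ) (Φ : H →L[ℝ] (Fin N → ℝ)), ∀ x, Φ x = 0 → ‖J x‖ ≤ ε * ‖x‖) :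
    IsCompactOperator J := by
  have h1 : ∀ n : ℕ, ∃ T : H →L[ℝ] H', IsCompactOperator T ∧ ‖J - T‖ ≤ 1 / ((n : ℝ) + 1) := by
    intro n
    obtain ⟨N, Φ, hΦ⟩ := h (1 / ((n : ℝ) + 1)) (by positivity)
    let K : Submodule ℝ H := LinearMap.ker (Φ : H →ₗ[ℝ] (Fin N → ℝ))
    have hKc : IsClosed (K : Set H) := Φ.isClosed_ker
    have : CompleteSpace K := hKc.completeSpace_coe
    -- Φ is injective on the complement of its kernel.
    have hfin : FiniteDimensional ℝ Kᗮ := by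
      let Ψ : Kᗮ →ₗ[ℝ] (Fin N → ℝ) := (Φ : H →ₗ[ℝ] (Fin N → ℝ)) ∘ₗ Kᗮ.subtype
      refine FiniteDimensional.of_injective Ψ ?_
      rw [← LinearMap.ker_eq_bot, LinearMap.ker_eq_bot']
      intro x hx
      have hxK : (x : H) ∈ K := hx
      have := x.2 _ hxK
      rw [inner_self_eq_zero] at this
      exact Subtype.ext this
    -- The finite-rank approximant is J after the projection onto `Kᗮ`; the error is J after the
    -- projection onto K, where J is small by assumption.
    refine ⟨(J ∘L Kᗮ.subtypeL) ∘L (Kᗮ).orthogonalProjectionOnto, ?_, ?_⟩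
    · refine IsCompactOperator.comp_clm (f := (J ∘L Kᗮ.subtypeL)) ?_ _
      have hid : IsCompactOperator (id : Kᗮ → Kᗮ) := by
        have := FiniteDimensional.proper ℝ Kᗮ
        exact isCompactOperator_id
      exact hid.clm_comp (J ∘L Kᗮ.subtypeL)
    · refine ContinuousLinearMap.opNorm_le_bound _ (by positivity) fun x => ?_
      have hx : (J - (J ∘L Kᗮ.subtypeL) ∘L (Kᗮ).orthogonalProjectionOnto) x
          = J (K.starProjection x) := by
        have h2 := K.starProjection_add_starProjection_orthogonal x
        conv_lhs => rw [_root_.sub_apply]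
        simp only [ContinuousLinearMap.comp_apply]
        rw [sub_eq_iff_eq_add]
        conv_lhs => rw [← h2, map_add]
        rfl
      rw [hx]
      refine (hΦ _ (K.starProjection_apply_mem x)).trans ?_
      gcongr
      exact K.norm_starProjection_apply_le x
  choose T hT hT' using h1
  refine isCompactOperator_of_tendsto (l := Filter.atTop) (F := T) (f := J) ?_
    (Filter.Eventually.of_forall hT)
  rw [tendsto_iff_norm_sub_tendsto_zero]
  refine squeeze_zero (fun n => norm_nonneg _) (fun n => ?_)
    (tendsto_one_div_add_atTop_nhds_zero_nat (𝕜 := ℝ))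
  rw [norm_sub_rev]
  exact hT' n

end CompactSelfAdjoint

/-! ### Weak eigenvalue problems and min-max bounds -/

section WeakForm

variable {E H : Type*} [NormedAddCommGroup E] [InnerProductSpace ℝ E]
  [NormedAddCommGroup H] [InnerProductSpace ℝ H]

/-- The relation "`f` belongs to the domain of the operator associated with the form `-a`, and the
operator maps `f` to `h`", for a form `a` on `E` and a map `J : E → H`. -/
def WeakRel (a : E →L[ℝ] E →L[ℝ] ℝ) (J : E →L[ℝ] H) (f h : H) : Prop :=
  ∃ x, J x = f ∧ ∀ y, a x y = -inner ℝ h (J y)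

variable (H) in
/-- The inner product of a real inner product space as a continuous bilinear form. -/
noncomputable def innerBilin : H →L[ℝ] H →L[ℝ] ℝ :=
  (isBoundedBilinearMap_inner (𝕜 := ℝ) (E := H)).toContinuousLinearMap

theorem WeakRel.smul {a : E →L[ℝ] E →L[ℝ] ℝ} {J : E →L[ℝ] H} {f h : H} (hr : WeakRel a J f h)
    (r : ℝ) : WeakRel a J (r • f) (r • h) := by
  obtain ⟨x, hx, hy⟩ := hr
  refine ⟨r • x, by rw [map_smul, hx], fun y => ?_⟩
  rw [map_smul, smul_apply, hy, inner_smul_left]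
  simp

/-- A form that is elliptic with respect to a compact embedding has an orthonormal basis of
eigenvectors. -/
theorem exists_weak_eigenbasis [CompleteSpace E] [CompleteSpace H] (hinf : ¬ FiniteDimensional ℝ H)
    {a : E →L[ℝ] E →L[ℝ] ℝ} {J : E →L[ℝ] H} (hsymm : ∀ x y, a x y = a y x)
    (hcoer : ∃ δ > 0, ∀ x, δ * ‖x‖ * ‖x‖ ≤ a x x + inner ℝ (J x) (J x))
    (hJ : IsCompactOperator J) (hsing : ∀ h, WeakRel a J 0 h → h = 0) :
    ∃ (f : HilbertBasis ℕ ℝ H) (eig : ℕ → ℝ), Antitone eig ∧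
      ∀ k, WeakRel a J (f k) (eig k • f k) := by
  -- Adding the inner product of H makes the form coercive. By Lax-Milgram, S solves `B (S f) y =
  -- ⟨f, J y⟩`, so `R = J ∘ S` is the resolvent (1 - A)⁻¹.
  let B : E →L[ℝ] E →L[ℝ] ℝ := a + (innerBilin H).bilinearComp J J
  have hB : ∀ x y, B x y = a x y + inner ℝ (J x) (J y) := fun x y => rfl
  have hBc : IsCoercive B := by
    obtain ⟨δ, hδ, h⟩ := hcoer
    exact ⟨δ, hδ, h⟩
  let S : H →L[ℝ] E := (hBc.continuousLinearEquivOfBilin.symm : E →L[ℝ] E) ∘L J.adjoint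
  have hS : ∀ f y, B (S f) y = inner ℝ f (J y) := by
    intro f y
    rw [← hBc.continuousLinearEquivOfBilin_apply]
    simp only [S, ContinuousLinearMap.comp_apply, ContinuousLinearEquiv.coe_coe,
      ContinuousLinearEquiv.apply_symm_apply]
    exact J.adjoint_inner_left y f
  let R : H →L[ℝ] H := J ∘L S
  have hR : ∀ f, R f = J (S f) := fun f => rfl
  have hin : ∀ f g, inner ℝ f (R g) = B (S f) (S g) := fun f g => (hS f (S g)).symm
  have hBs : ∀ x y, B x y = B y x := by
    intro x y
    rw [hB, hB, hsymm, real_inner_comm]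
  have hRs : (R : H →ₗ[ℝ] H).IsSymmetric := by
    intro f g
    simp only [ContinuousLinearMap.coe_coe]
    rw [real_inner_comm, hin, hin, hBs]
  have hrel : ∀ f, WeakRel a J (R f) (R f - f) := by
    intro f
    refine ⟨S f, rfl, fun y => ?_⟩
    have := hS f y
    rw [hB] at this
    rw [inner_sub_left, hR]
    linarith
  have hpos : ∀ f, 0 ≤ inner ℝ (R f) f := by
    intro f
    rw [real_inner_comm, hin]
    obtain ⟨δ, hδ, h⟩ := hBc
    exact le_trans (by positivity) (h (S f))
  -- If `R f = 0`, the weak relation sends 0 to -f; `hsing` says that it is single-valued at 0.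
  have hinj : ∀ f, R f = 0 → f = 0 := by
    intro f hf
    have h := hrel f
    rw [hf] at h
    simpa using hsing _ h
  obtain ⟨f, m, hm, hmpos, hfm⟩ := exists_hilbertBasis_of_compact_pos hinf (hJ.comp_clm S) hRs
    hpos hinj
  -- From m = 1 / (1 - λ); this is increasing in m, so the order is preserved.
  refine ⟨f, fun k => 1 - (m k)⁻¹, fun i j hij => ?_, fun k => ?_⟩
  · have := inv_anti₀ (hmpos j) (hm hij)
    simp only
    linarith
  · have h := (hrel (f k)).smul (m k)⁻¹
    rw [hfm, smul_sub, inv_smul_smul₀ (hmpos k).ne'] at h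
    rw [sub_smul, one_smul]
    exact h

variable {a : E →L[ℝ] E →L[ℝ] ℝ} {J : E →L[ℝ] H}

theorem WeakRel.eigenvalue_nonpos (hpos : ∀ x, 0 ≤ a x x) {f : H} (hf : ‖f‖ = 1) {r : ℝ}
    (h : WeakRel a J f (r • f)) : r ≤ 0 := by
  obtain ⟨x, hx, hy⟩ := h
  have h1 := hpos x
  rw [hy, hx, inner_smul_left, real_inner_self_eq_norm_sq, hf] at h1
  simp at h1
  linarith

/-- The values of the form on combinations of weak eigenvectors. -/
theorem form_sum_apply {ι : Type*} (s : Finset ι) {f : ι → H} {x : ι → E} {eig : ι → ℝ}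
    (hy : ∀ i y, a (x i) y = -inner ℝ (eig i • f i) (J y)) (c : ι → ℝ) (y : E) :
    a (∑ i ∈ s, c i • x i) y = ∑ i ∈ s, c i * (-eig i) * inner ℝ (f i) (J y) := by
  rw [map_sum, _root_.sum_apply]
  refine Finset.sum_congr rfl fun i _ => ?_
  rw [map_smul, smul_apply, hy, inner_smul_left, smul_eq_mul]
  simp only [conj_trivial]
  ring

/-- Quadratic lower bound for the eigenvalues from approximation by finitely many functionals. -/
theorem exists_quadratic_lower_bound {f : ℕ → H} (hf : Orthonormal ℝ f) {eig : ℕ → ℝ}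
    (heig : Antitone eig) (hw : ∀ k, WeakRel a J (f k) (eig k • f k)) (hpos : ∀ x, 0 ≤ a x x)
    {m : ℕ} (hm : 0 < m) {C : ℝ} (hC : 0 < C)
    (happ : ∀ n : ℕ, 0 < n → ∃ Φ : E →ₗ[ℝ] (Fin (m * n) → ℝ), ∀ x, Φ x = 0 →
      (n : ℝ) ^ 2 * ‖J x‖ ^ 2 ≤ C * a x x) {lam : ℝ} (hlam : 0 < lam) :
    ∃ l > 0, ∀ k : ℕ, l * ((k : ℝ) + 1) ^ 2 ≤ lam - eig k := by
  choose x hx hy using hw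
  have hm' : (0 : ℝ) < m := by exact_mod_cast hm
  have key : ∀ n k : ℕ, 0 < n → m * n ≤ k → (n : ℝ) ^ 2 ≤ C * (-eig k) := by
    intro n k hn hnk
    obtain ⟨Φ, hΦ⟩ := happ n hn
    let b : (Fin (k + 1) → ℝ) →ₗ[ℝ] E :=
      Fintype.linearCombination ℝ (fun i : Fin (k + 1) => x i)
    -- The k + 1 coefficients outnumber the m * n ≤ k conditions.
    obtain ⟨s, hs, hs0⟩ := Submodule.exists_mem_ne_zero_of_ne_bot
      (LinearMap.ker_ne_bot_of_finrank_lt (f := Φ ∘ₗ b) (by simp; omega))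
    have hbs : b s = ∑ i : Fin (k + 1), s i • x i := Fintype.linearCombination_apply ℝ _ _
    have hJ : J (b s) = ∑ i : Fin (k + 1), s i • f i := by
      rw [hbs, map_sum]
      simp only [map_smul, hx]
    have hfk : Orthonormal ℝ fun i : Fin (k + 1) => f i := hf.comp _ Fin.val_injective
    have hcoef : ∀ i : Fin (k + 1), inner ℝ (f i) (J (b s)) = s i := by
      intro i
      rw [hJ]
      exact hfk.inner_right_fintype s i
    have hnorm : ‖J (b s)‖ ^ 2 = ∑ i : Fin (k + 1), s i ^ 2 := by
      rw [← real_inner_self_eq_norm_sq]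
      conv_lhs => rw [hJ, sum_inner]
      refine Finset.sum_congr rfl fun i _ => ?_
      rw [← hJ, inner_smul_left, hcoef]
      simp [sq]
    have hpos' : 0 < ‖J (b s)‖ ^ 2 := by
      rw [hnorm]
      obtain ⟨i, hi⟩ := Function.ne_iff.mp hs0
      exact Finset.sum_pos' (fun i _ => sq_nonneg _)
        ⟨i, Finset.mem_univ _, by have : s i ≠ 0 := hi; positivity⟩
    have ha : a (b s) (b s) ≤ -eig k * ‖J (b s)‖ ^ 2 := by
      conv_lhs => rw [hbs]
      rw [form_sum_apply Finset.univ (x := fun i : Fin (k + 1) => x i)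
        (f := fun i : Fin (k + 1) => f i) (eig := fun i : Fin (k + 1) => eig i)
        (fun i => hy i), ← hbs, hnorm, Finset.mul_sum]
      refine Finset.sum_le_sum fun i _ => ?_
      rw [hcoef]
      have : eig k ≤ eig i := heig (Nat.lt_succ_iff.mp i.2)
      nlinarith [sq_nonneg (s i)]
    have h1 := hΦ (b s) hs
    have h2 : (n : ℝ) ^ 2 * ‖J (b s)‖ ^ 2 ≤ C * (-eig k) * ‖J (b s)‖ ^ 2 := by
      nlinarith
    exact le_of_mul_le_mul_right h2 hpos'
  -- The first constant serves k < m, where only `lam` is available and k + 1 ≤ m. The second serves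
  -- k ≥ m: `key` is used with n = k / m, and k + 1 ≤ 2 m n.
  refine ⟨min (lam / (m : ℝ) ^ 2) (1 / (4 * C * (m : ℝ) ^ 2)), by positivity, fun k => ?_⟩
  have hk0 : eig k ≤ 0 := WeakRel.eigenvalue_nonpos hpos (hf.1 k) ⟨x k, hx k, hy k⟩
  rcases lt_or_ge k m with hkm | hkm
  · have h1 : (k : ℝ) + 1 ≤ m := by exact_mod_cast hkm
    calc min (lam / (m : ℝ) ^ 2) (1 / (4 * C * (m : ℝ) ^ 2)) * ((k : ℝ) + 1) ^ 2
        ≤ lam / (m : ℝ) ^ 2 * (m : ℝ) ^ 2 := by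
          gcongr
          exact min_le_left _ _
      _ = lam := by field_simp
      _ ≤ lam - eig k := by linarith
  · have hn : 0 < k / m := Nat.div_pos hkm hm
    have h1 := key (k / m) k hn (Nat.mul_div_le k m)
    have h2 : k + 1 ≤ 2 * m * (k / m) := by
      have := Nat.div_add_mod k m
      have := Nat.mod_lt k hm
      nlinarith
    have h3 : (k : ℝ) + 1 ≤ 2 * m * ((k / m : ℕ) : ℝ) := by exact_mod_cast h2
    calc min (lam / (m : ℝ) ^ 2) (1 / (4 * C * (m : ℝ) ^ 2)) * ((k : ℝ) + 1) ^ 2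
        ≤ 1 / (4 * C * (m : ℝ) ^ 2) * (2 * m * ((k / m : ℕ) : ℝ)) ^ 2 := by
          gcongr
          exact min_le_right _ _
      _ = ((k / m : ℕ) : ℝ) ^ 2 / C := by field_simp; norm_num
      _ ≤ -eig k := by
          rw [div_le_iff₀ hC]
          linarith
      _ ≤ lam - eig k := by linarith

/-- Quadratic upper bound for the eigenvalues from test spaces satisfying an inverse inequality. -/
theorem exists_quadratic_upper_bound (f : HilbertBasis ℕ ℝ H) {eig : ℕ → ℝ}
    (heig : Antitone eig) (hw : ∀ k, WeakRel a J (f k) (eig k • f k)) (hpos : ∀ x, 0 ≤ a x x)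
    (hsymm : ∀ x y, a x y = a y x) {C : ℝ} (hC : 0 ≤ C)
    (htest : ∀ n : ℕ, 0 < n → ∃ b : (Fin n → ℝ) →ₗ[ℝ] E, (∀ s, J (b s) = 0 → s = 0) ∧
      ∀ s, a (b s) (b s) ≤ C * (n : ℝ) ^ 2 * ‖J (b s)‖ ^ 2) {lam : ℝ} (hlam : 0 < lam) :
    ∃ l > 0, ∀ k : ℕ, lam - eig k ≤ l * ((k : ℝ) + 1) ^ 2 := by
  have hneg : ∀ k, eig k ≤ 0 := fun k =>
    WeakRel.eigenvalue_nonpos hpos (f.orthonormal.1 k) (hw k)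
  choose x hx hy using hw
  refine ⟨lam + C, by positivity, fun k => ?_⟩
  -- A test space of dimension k + 1 contains a nonzero z with `J z` orthogonal to the k
  -- eigenvectors `f 0, …, f (k - 1)`.
  obtain ⟨b, hb, hab⟩ := htest (k + 1) k.succ_pos
  let Ψ : (Fin (k + 1) → ℝ) →ₗ[ℝ] (Fin k → ℝ) :=
    LinearMap.pi fun i => (innerSL ℝ (f i) : H →ₗ[ℝ] ℝ) ∘ₗ (J : E →ₗ[ℝ] H) ∘ₗ b
  obtain ⟨s, hs, hs0⟩ := Submodule.exists_mem_ne_zero_of_ne_bot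
    (LinearMap.ker_ne_bot_of_finrank_lt (f := Ψ) (by simp))
  set z := b s with hz
  have hz0 : J z ≠ 0 := fun h => hs0 (hb s h)
  have hc0 : ∀ j < k, inner ℝ (f j) (J z) = (0 : ℝ) := fun j hj =>
    congrFun (LinearMap.mem_ker.mp hs) ⟨j, hj⟩
  -- A Bessel inequality for the form: the truncated expansion P of z satisfies a(P, P) = a(P, z),
  -- so a(z - P, z - P) ≥ 0 gives a(P, z) ≤ a(z, z). No convergence in the form norm is needed;
  -- Parseval in H is applied afterwards.
  have hN : ∀ N : ℕ, (-eig k) * ∑ j ∈ Finset.range N, inner ℝ (J z) (f j) * inner ℝ (f j) (J z)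
      ≤ a z z := by
    intro N
    let c : ℕ → ℝ := fun j => inner ℝ (f j) (J z)
    let P := ∑ j ∈ Finset.range N, c j • x j
    have hJP : J P = ∑ j ∈ Finset.range N, c j • f j := by
      simp only [P, map_sum, map_smul, hx]
    have hPz : a P z = ∑ j ∈ Finset.range N, c j * (-eig j) * c j :=
      form_sum_apply _ hy c z
    have hPP : a P P = a P z := by
      rw [hPz]
      refine (form_sum_apply _ hy c P).trans (Finset.sum_congr rfl fun j hj => ?_)
      rw [hJP, f.orthonormal.inner_right_sum c hj]
    have h1 := hpos (z - P)
    simp only [map_sub, sub_apply] at h1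
    rw [hsymm z P, hPP] at h1
    refine le_trans ?_ (show a P z ≤ a z z by linarith)
    rw [hPz, Finset.mul_sum]
    refine Finset.sum_le_sum fun j _ => ?_
    rw [real_inner_comm (f j) (J z)]
    change _ * (c j * c j) ≤ _
    rcases lt_or_ge j k with hj | hj
    · have : c j = 0 := hc0 j hj
      simp [this]
    · have := heig hj
      nlinarith [mul_self_nonneg (c j)]
  have hlim := (f.hasSum_inner_mul_inner (J z) (J z)).tendsto_sum_nat.const_mul (-eig k)
  have h2 := le_of_tendsto' hlim hN
  rw [real_inner_self_eq_norm_sq] at h2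
  have h3 := hab s
  rw [← hz] at h3
  have h4 : -eig k ≤ C * ((k + 1 : ℕ) : ℝ) ^ 2 :=
    le_of_mul_le_mul_right (h2.trans h3) (by positivity)
  push_cast at h4
  nlinarith [sq_nonneg (k : ℝ), (Nat.cast_nonneg k : (0 : ℝ) ≤ k),
    mul_nonneg hlam.le (sq_nonneg (k : ℝ)), mul_nonneg hlam.le (Nat.cast_nonneg k : (0 : ℝ) ≤ k)]

theorem not_finiteDimensional_of_test (J : E →L[ℝ] H)
    (htest : ∀ n : ℕ, 0 < n → ∃ b : (Fin n → ℝ) →ₗ[ℝ] E, ∀ s, J (b s) = 0 → s = 0) :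
    ¬ FiniteDimensional ℝ H := by
  intro hfin
  obtain ⟨b, hb⟩ := htest (Module.finrank ℝ H + 1) (Nat.succ_pos _)
  have hinj : Function.Injective ((J : E →ₗ[ℝ] H) ∘ₗ b) := by
    rw [← LinearMap.ker_eq_bot, LinearMap.ker_eq_bot']
    exact hb
  have := LinearMap.finrank_le_finrank_of_injective hinj
  simp at this

/-- The relation `WeakRel` for a form with domain `K`. -/
def WeakRelOn (a : E →L[ℝ] E →L[ℝ] ℝ) (J : E →L[ℝ] H) (K : Submodule ℝ E) (f h : H) : Prop :=
  ∃ x ∈ K, J x = f ∧ ∀ y ∈ K, a x y = -inner ℝ h (J y)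

theorem weakRelOn_iff (a : E →L[ℝ] E →L[ℝ] ℝ) (J : E →L[ℝ] H) (K : Submodule ℝ E) (f h : H) :
    WeakRelOn a J K f h ↔
      WeakRel (E := K) (a.bilinearComp K.subtypeL K.subtypeL) (J ∘L K.subtypeL) f h :=
  ⟨fun ⟨x, hx, hf, hy⟩ => ⟨⟨x, hx⟩, hf, fun y => hy y y.2⟩,
    fun ⟨x, hf, hy⟩ => ⟨x, x.2, hf, fun y hy' => hy ⟨y, hy'⟩⟩⟩

/-- A closed subspace K is a Hilbert space, and symmetry, ellipticity and compactness all pass to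
restrictions. The form and the embedding can thus live on the larger space E, the vertex conditions
entering only through K. -/
theorem exists_weak_eigenbasis_on [CompleteSpace E] [CompleteSpace H]
    (hinf : ¬ FiniteDimensional ℝ H) {K : Submodule ℝ E} (hK : IsClosed (K : Set E))
    (hsymm : ∀ x y, a x y = a y x)
    (hcoer : ∃ δ > 0, ∀ x, δ * ‖x‖ * ‖x‖ ≤ a x x + inner ℝ (J x) (J x))
    (hJ : IsCompactOperator J) (hsing : ∀ h, WeakRelOn a J K 0 h → h = 0) :
    ∃ (f : HilbertBasis ℕ ℝ H) (eig : ℕ → ℝ), Antitone eig ∧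
      ∀ k, WeakRelOn a J K (f k) (eig k • f k) := by
  have : CompleteSpace K := hK.completeSpace_coe
  simp only [weakRelOn_iff] at hsing ⊢
  obtain ⟨δ, hδ, h⟩ := hcoer
  exact exists_weak_eigenbasis hinf (fun x y => hsymm x y) ⟨δ, hδ, fun x => h x⟩
    (hJ.comp_clm K.subtypeL) hsing

theorem exists_quadratic_lower_bound_on {K : Submodule ℝ E} {f : ℕ → H} (hf : Orthonormal ℝ f)
    {eig : ℕ → ℝ} (heig : Antitone eig) (hw : ∀ k, WeakRelOn a J K (f k) (eig k • f k))
    (hpos : ∀ x, 0 ≤ a x x) {m : ℕ} (hm : 0 < m) {C : ℝ} (hC : 0 < C)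
    (happ : ∀ n : ℕ, 0 < n → ∃ Φ : E →ₗ[ℝ] (Fin (m * n) → ℝ), ∀ x, Φ x = 0 →
      (n : ℝ) ^ 2 * ‖J x‖ ^ 2 ≤ C * a x x) {lam : ℝ} (hlam : 0 < lam) :
    ∃ l > 0, ∀ k : ℕ, l * ((k : ℝ) + 1) ^ 2 ≤ lam - eig k := by
  simp only [weakRelOn_iff] at hw
  refine exists_quadratic_lower_bound hf heig hw (fun x => hpos x) hm hC (fun n hn => ?_) hlam
  obtain ⟨Φ, hΦ⟩ := happ n hn
  exact ⟨Φ ∘ₗ K.subtype, fun x hx => hΦ x hx⟩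

theorem exists_quadratic_upper_bound_on {K : Submodule ℝ E} (f : HilbertBasis ℕ ℝ H)
    {eig : ℕ → ℝ} (heig : Antitone eig) (hw : ∀ k, WeakRelOn a J K (f k) (eig k • f k))
    (hpos : ∀ x, 0 ≤ a x x) (hsymm : ∀ x y, a x y = a y x) {C : ℝ} (hC : 0 ≤ C)
    (htest : ∀ n : ℕ, 0 < n → ∃ b : (Fin n → ℝ) →ₗ[ℝ] E, (∀ s, b s ∈ K) ∧
      (∀ s, J (b s) = 0 → s = 0) ∧ ∀ s, a (b s) (b s) ≤ C * (n : ℝ) ^ 2 * ‖J (b s)‖ ^ 2)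
    {lam : ℝ} (hlam : 0 < lam) :
    ∃ l > 0, ∀ k : ℕ, lam - eig k ≤ l * ((k : ℝ) + 1) ^ 2 := by
  simp only [weakRelOn_iff] at hw
  refine exists_quadratic_upper_bound f heig hw (fun x => hpos x) (fun x y => hsymm x y) hC
    (fun n hn => ?_) hlam
  obtain ⟨b, hbK, hb0, hb⟩ := htest n hn
  exact ⟨b.codRestrict K hbK, hb0, hb⟩

end WeakForm

/-! ### Sobolev functions and trigonometric integrals on an interval -/

section Interval

theorem IsH1.of_primitive {l : ℝ} {g : ℝ → ℝ} (hg : MemLp g 2 (volume.restrict (Ioo 0 l)))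
    (a : ℝ) : IsH1 l (fun x => a + ∫ t in (0 : ℝ)..x, g t) g :=
  ⟨hg, fun x _ => by simp⟩

theorem IsH1.memLp {l : ℝ} {u u' : ℝ → ℝ} (hu : IsH1 l u u') :
    MemLp u 2 (volume.restrict (Ioo 0 l)) := by
  obtain ⟨C, hC⟩ := isCompact_Icc.exists_bound_of_continuousOn hu.continuousOn
  refine MemLp.of_bound
    ((hu.continuousOn.mono Ioo_subset_Icc_self).aestronglyMeasurable measurableSet_Ioo) C ?_
  filter_upwards [ae_restrict_mem measurableSet_Ioo] with x hx
  exact hC x (Ioo_subset_Icc_self hx)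

theorem integral_Ioo_eq_intervalIntegral {l : ℝ} (hl : 0 ≤ l) (f : ℝ → ℝ) :
    ∫ x in Ioo 0 l, f x = ∫ x in (0 : ℝ)..l, f x := by
  rw [intervalIntegral.integral_of_le hl, integral_Ioc_eq_integral_Ioo]

/-- Integration by parts for `H¹` functions. -/
theorem IsH1.integral_mul_deriv {l : ℝ} (hl : 0 < l) {u u' v v' : ℝ → ℝ} (hu : IsH1 l u u')
    (hv : IsH1 l v v') :
    ∫ x in Ioo 0 l, u x * v' x = u l * v l - u 0 * v 0 - ∫ x in Ioo 0 l, u' x * v x := by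
  have hac : ∀ {w w' : ℝ → ℝ}, IsH1 l w w' →
      AbsolutelyContinuousOnInterval (fun x => w 0 + ∫ t in (0 : ℝ)..x, w' t) 0 l := by
    intro w w' hw
    have h1 := (hw.intervalIntegrable (right_mem_Icc.mpr hl.le)
      ).absolutelyContinuousOnInterval_intervalIntegral (c := 0) left_mem_uIcc
    have h2 : AbsolutelyContinuousOnInterval (fun _ : ℝ => w 0) 0 l :=
      (LipschitzWith.const (w 0)).lipschitzOnWith.absolutelyContinuousOnInterval
    exact h2.add h1
  have hd : ∀ {w w' : ℝ → ℝ}, IsH1 l w w' → ∀ᵐ x ∂(volume.restrict (Ioo 0 l)),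
      deriv (fun x => w 0 + ∫ t in (0 : ℝ)..x, w' t) x = w' x := by
    intro w w' hw
    filter_upwards [(IsH1.of_primitive hw.1 (w 0)).ae_hasDerivAt hl] with x hx
    exact hx.deriv
  have key := (hac hu).integral_mul_deriv_eq_deriv_mul (hac hv)
  simp only [intervalIntegral.integral_same, add_zero] at key
  rw [← hu.2 l (right_mem_Icc.mpr hl.le), ← hv.2 l (right_mem_Icc.mpr hl.le)] at key
  rw [← integral_Ioo_eq_intervalIntegral hl.le, ← integral_Ioo_eq_intervalIntegral hl.le] at key
  convert key using 1
  · refine integral_congr_ae ?_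
    filter_upwards [hd hv, ae_restrict_mem measurableSet_Ioo] with x h1 h2
    rw [h1, ← hu.2 x (Ioo_subset_Icc_self h2)]
  · congr 1
    refine integral_congr_ae ?_
    filter_upwards [hd hu, ae_restrict_mem measurableSet_Ioo] with x h1 h2
    rw [h1, ← hv.2 x (Ioo_subset_Icc_self h2)]

/-- Cauchy-Schwarz against the constant 1, obtained by integrating (f - m)² ≥ 0 with m the mean of
f. -/
theorem sq_integral_le {a b : ℝ} (hab : a ≤ b) {f : ℝ → ℝ} (hf : IntervalIntegrable f volume a b)
    (hf2 : IntervalIntegrable (fun x => f x ^ 2) volume a b) :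
    (∫ x in a..b, f x) ^ 2 ≤ (b - a) * ∫ x in a..b, f x ^ 2 := by
  rcases hab.eq_or_lt with rfl | hlt
  · simp
  set m := (∫ x in a..b, f x) / (b - a) with hm
  have h0 : ∫ x in a..b, (2 * m * f x - m ^ 2) ≤ ∫ x in a..b, f x ^ 2 := by
    refine intervalIntegral.integral_mono_on hab ((hf.const_mul _).sub (by simp)) hf2
      fun x _ => ?_
    nlinarith [sq_nonneg (f x - m)]
  rw [intervalIntegral.integral_sub (hf.const_mul _) (by simp),
    intervalIntegral.integral_const_mul, intervalIntegral.integral_const, smul_eq_mul] at h0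
  have hne : b - a ≠ 0 := (sub_pos.mpr hlt).ne'
  have h1 : ∫ x in a..b, f x = m * (b - a) := by rw [hm]; field_simp
  rw [h1] at h0 ⊢
  nlinarith [sub_pos.mpr hlt]

theorem IsH1.intervalIntegrable_sq {l : ℝ} {u u' : ℝ → ℝ} (hu : IsH1 l u u') {s t : ℝ}
    (hs : 0 ≤ s) (hst : s ≤ t) (ht : t ≤ l) :
    IntervalIntegrable (fun x => u' x ^ 2) volume s t := by
  rw [intervalIntegrable_iff_integrableOn_Ioo_of_le hst]
  have h : IntegrableOn (fun x => u' x ^ 2) (Ioo 0 l) := hu.1.integrable_sq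
  exact h.mono_set (Ioo_subset_Ioo hs ht)

theorem IsH1.intervalIntegrable_deriv {l : ℝ} {u u' : ℝ → ℝ} (hu : IsH1 l u u') {s t : ℝ}
    (hs : 0 ≤ s) (hst : s ≤ t) (ht : t ≤ l) : IntervalIntegrable u' volume s t :=
  (hu.intervalIntegrable ⟨hs, hst.trans ht⟩).symm.trans
    (hu.intervalIntegrable ⟨hs.trans hst, ht⟩)

theorem IsH1.sq_sub_le {l : ℝ} {u u' : ℝ → ℝ} (hu : IsH1 l u u') {s t : ℝ}
    (hs : 0 ≤ s) (hst : s ≤ t) (ht : t ≤ l) :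
    (u t - u s) ^ 2 ≤ (t - s) * ∫ x in s..t, u' x ^ 2 := by
  have h1 : u t - u s = ∫ x in s..t, u' x := by
    rw [hu.2 t ⟨hs.trans hst, ht⟩, hu.2 s ⟨hs, hst.trans ht⟩, add_sub_add_left_eq_sub,
      intervalIntegral.integral_interval_sub_left (hu.intervalIntegrable ⟨hs.trans hst, ht⟩)
        (hu.intervalIntegrable ⟨hs, hst.trans ht⟩)]
  rw [h1]
  exact sq_integral_le hst (hu.intervalIntegrable_deriv hs hst ht)
    (hu.intervalIntegrable_sq hs hst ht)

/-- A Poincaré inequality for functions that vanish at equidistant points. -/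
theorem IsH1.poincare {l : ℝ} (hl : 0 < l) {u u' : ℝ → ℝ} (hu : IsH1 l u u') {n : ℕ}
    (hn : 0 < n) (h0 : ∀ j < n, u (j * (l / n)) = 0) :
    (n : ℝ) ^ 2 * ∫ x in Ioo 0 l, u x ^ 2 ≤ l ^ 2 * ∫ x in Ioo 0 l, u' x ^ 2 := by
  have hn' : (0 : ℝ) < n := by exact_mod_cast hn
  set h := l / n with hh
  have hhpos : 0 < h := by positivity
  have hnh : (n : ℝ) * h = l := by rw [hh]; field_simp
  let p : ℕ → ℝ := fun j => j * h
  have hp0 : ∀ j, 0 ≤ p j := fun j => by positivity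
  have hpl : ∀ j ≤ n, p j ≤ l := fun j hj => by
    rw [← hnh]
    have : (j : ℝ) ≤ n := by exact_mod_cast hj
    exact mul_le_mul_of_nonneg_right this hhpos.le
  have hps : ∀ j, p (j + 1) = p j + h := fun j => by simp only [p]; push_cast; ring
  have hu2 : ∀ j < n, IntervalIntegrable (fun x => u x ^ 2) volume (p j) (p (j + 1)) := by
    intro j hj
    refine ContinuousOn.intervalIntegrable_of_Icc (by rw [hps]; linarith)
      ((hu.continuousOn.mono (Icc_subset_Icc (hp0 j) (hpl (j + 1) hj))).pow 2)
  have hd2 : ∀ j < n, IntervalIntegrable (fun x => u' x ^ 2) volume (p j) (p (j + 1)) :=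
    fun j hj => hu.intervalIntegrable_sq (hp0 j) (by rw [hps]; linarith) (hpl (j + 1) hj)
  have hsum : ∀ f : ℝ → ℝ, (∀ j < n, IntervalIntegrable f volume (p j) (p (j + 1))) →
      ∫ x in Ioo 0 l, f x = ∑ j ∈ Finset.range n, ∫ x in p j..p (j + 1), f x := by
    intro f hf
    rw [intervalIntegral.sum_integral_adjacent_intervals hf, integral_Ioo_eq_intervalIntegral hl.le]
    simp [p, hnh]
  rw [hsum _ hu2, hsum _ hd2, Finset.mul_sum, Finset.mul_sum]
  refine Finset.sum_le_sum fun j hj => ?_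
  have hj' := Finset.mem_range.mp hj
  have hle : p j ≤ p (j + 1) := by rw [hps]; linarith
  -- Since u vanishes at the left end of the cell, its values are controlled by the energy in the
  -- cell; integrating over the cell yields a second factor h.
  have hpt : ∀ x ∈ Icc (p j) (p (j + 1)),
      u x ^ 2 ≤ h * ∫ t in p j..p (j + 1), u' t ^ 2 := by
    intro x hx
    have h1 := hu.sq_sub_le (hp0 j) hx.1 (hx.2.trans (hpl (j + 1) hj'))
    rw [h0 j hj', sub_zero] at h1
    refine h1.trans ?_
    have hx2 : x ≤ p j + h := by rw [← hps]; exact hx.2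
    have h2 : ∫ t in p j..x, u' t ^ 2 ≤ ∫ t in p j..p (j + 1), u' t ^ 2 :=
      intervalIntegral.integral_mono_interval le_rfl hx.1 hx.2
        (Filter.Eventually.of_forall fun t => sq_nonneg _) (hd2 j hj')
    have h3 : 0 ≤ ∫ t in p j..x, u' t ^ 2 :=
      intervalIntegral.integral_nonneg hx.1 fun t _ => sq_nonneg _
    exact mul_le_mul (by linarith) h2 h3 hhpos.le
  have h4 : ∫ x in p j..p (j + 1), u x ^ 2 ≤
      ∫ x in p j..p (j + 1), h * ∫ t in p j..p (j + 1), u' t ^ 2 :=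
    intervalIntegral.integral_mono_on hle (hu2 j hj') (by simp) hpt
  rw [intervalIntegral.integral_const, smul_eq_mul, hps, add_sub_cancel_left, ← hps] at h4
  calc (n : ℝ) ^ 2 * ∫ x in p j..p (j + 1), u x ^ 2
      ≤ (n : ℝ) ^ 2 * (h * (h * ∫ t in p j..p (j + 1), u' t ^ 2)) := by gcongr
    _ = l ^ 2 * ∫ t in p j..p (j + 1), u' t ^ 2 := by rw [← hnh]; ring

/-- The lemma of du Bois-Reymond. -/
theorem exists_ae_eq_const {l : ℝ} (hl : 0 < l) {g : ℝ → ℝ}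
    (hg : MemLp g 2 (volume.restrict (Ioo 0 l)))
    (h : ∀ φ : ℝ → ℝ, MemLp φ 2 (volume.restrict (Ioo 0 l)) → ∫ x in Ioo 0 l, φ x = 0 →
      ∫ x in Ioo 0 l, g x * φ x = 0) :
    ∃ m : ℝ, g =ᵐ[volume.restrict (Ioo 0 l)] fun _ => m := by
  -- With m the mean of g, the function g - m is itself an admissible test function, and ∫ (g - m)²
  -- = 0.
  set m := (∫ x in Ioo 0 l, g x) / l with hm
  have hgi : IntegrableOn g (Ioo 0 l) := hg.integrable (by norm_num)
  have hφ : MemLp (fun x => g x - m) 2 (volume.restrict (Ioo 0 l)) := hg.sub (memLp_const m)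
  have h0 : ∫ x in Ioo 0 l, (g x - m) = 0 := by
    rw [integral_sub hgi (by simp)]
    simp [hl.le, hm]
    field_simp
    simp
  have h1 := h _ hφ h0
  have h2 : ∫ x in Ioo 0 l, (g x - m) ^ 2 = 0 := by
    have : ∀ x, (g x - m) ^ 2 = g x * (g x - m) - m * (g x - m) := fun x => by ring
    simp only [this]
    have hi : IntegrableOn (fun x => g x * (g x - m)) (Ioo 0 l) := hg.integrable_mul hφ
    rw [integral_sub hi ((hφ.integrable (by norm_num)).const_mul m), h1,
      integral_const_mul, h0]
    simp
  refine ⟨m, ?_⟩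
  rw [integral_eq_zero_iff_of_nonneg (fun x => sq_nonneg _) hφ.integrable_sq] at h2
  filter_upwards [h2] with x hx
  have : (g x - m) ^ 2 = 0 := hx
  rw [sq_eq_zero_iff, sub_eq_zero] at this
  exact this

theorem integral_cos_int {l : ℝ} (hl : 0 < l) (m : ℤ) :
    ∫ x in Ioo 0 l, Real.cos (m * (Real.pi / l) * x) = if m = 0 then l else 0 := by
  rw [integral_Ioo_eq_intervalIntegral hl.le]
  split_ifs with hm
  · simp [hm]
  · have hm' : (m : ℝ) * (Real.pi / l) ≠ 0 :=
      mul_ne_zero (by exact_mod_cast hm) (div_pos Real.pi_pos hl).ne'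
    rw [intervalIntegral.integral_comp_mul_left _ hm', integral_cos]
    have : (m : ℝ) * (Real.pi / l) * l = m * Real.pi := by field_simp
    simp [this, Real.sin_int_mul_pi]

theorem integral_sin_mul_sin {l : ℝ} (hl : 0 < l) (i j : ℕ) :
    ∫ x in Ioo 0 l, Real.sin (((i : ℝ) + 1) * (Real.pi / l) * x) *
      Real.sin (((j : ℝ) + 1) * (Real.pi / l) * x) = if i = j then l / 2 else 0 := by
  have h : ∀ x, Real.sin (((i : ℝ) + 1) * (Real.pi / l) * x) *
      Real.sin (((j : ℝ) + 1) * (Real.pi / l) * x) =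
      1 / 2 * Real.cos (((i - j : ℤ) : ℝ) * (Real.pi / l) * x)
      - 1 / 2 * Real.cos (((i + j + 2 : ℤ) : ℝ) * (Real.pi / l) * x) := by
    intro x
    have h1 := Real.cos_sub (((i : ℝ) + 1) * (Real.pi / l) * x) (((j : ℝ) + 1) * (Real.pi / l) * x)
    have h2 := Real.cos_add (((i : ℝ) + 1) * (Real.pi / l) * x) (((j : ℝ) + 1) * (Real.pi / l) * x)
    have e1 : ((i - j : ℤ) : ℝ) * (Real.pi / l) * x = ((i : ℝ) + 1) * (Real.pi / l) * x -
      ((j : ℝ) + 1) * (Real.pi / l) * x := by push_cast; ring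
    have e2 : ((i + j + 2 : ℤ) : ℝ) * (Real.pi / l) * x = ((i : ℝ) + 1) * (Real.pi / l) * x +
      ((j : ℝ) + 1) * (Real.pi / l) * x := by push_cast; ring
    rw [e1, e2, h1, h2]
    ring
  have hint : ∀ m : ℤ, IntegrableOn (fun x => 1 / 2 * Real.cos (m * (Real.pi / l) * x))
      (Ioo 0 l) := fun m =>
    (Continuous.integrableOn_Icc (by fun_prop)).mono_set Ioo_subset_Icc_self
  simp only [h]
  rw [integral_sub (hint _) (hint _), integral_const_mul, integral_const_mul, integral_cos_int hl,
    integral_cos_int hl, if_neg (show ¬ ((i : ℤ) + j + 2 = 0) by omega)]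
  by_cases hij : i = j
  · simp [hij]; ring
  · rw [if_neg hij, if_neg (by omega)]; simp

theorem integral_cos_mul_cos {l : ℝ} (hl : 0 < l) (i j : ℕ) :
    ∫ x in Ioo 0 l, Real.cos (((i : ℝ) + 1) * (Real.pi / l) * x) *
      Real.cos (((j : ℝ) + 1) * (Real.pi / l) * x) = if i = j then l / 2 else 0 := by
  have h : ∀ x, Real.cos (((i : ℝ) + 1) * (Real.pi / l) * x) *
      Real.cos (((j : ℝ) + 1) * (Real.pi / l) * x) =
      1 / 2 * Real.cos (((i - j : ℤ) : ℝ) * (Real.pi / l) * x)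
      + 1 / 2 * Real.cos (((i + j + 2 : ℤ) : ℝ) * (Real.pi / l) * x) := by
    intro x
    have h1 := Real.cos_sub (((i : ℝ) + 1) * (Real.pi / l) * x) (((j : ℝ) + 1) * (Real.pi / l) * x)
    have h2 := Real.cos_add (((i : ℝ) + 1) * (Real.pi / l) * x) (((j : ℝ) + 1) * (Real.pi / l) * x)
    have e1 : ((i - j : ℤ) : ℝ) * (Real.pi / l) * x = ((i : ℝ) + 1) * (Real.pi / l) * x -
      ((j : ℝ) + 1) * (Real.pi / l) * x := by push_cast; ring
    have e2 : ((i + j + 2 : ℤ) : ℝ) * (Real.pi / l) * x = ((i : ℝ) + 1) * (Real.pi / l) * x +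
      ((j : ℝ) + 1) * (Real.pi / l) * x := by push_cast; ring
    rw [e1, e2, h1, h2]
    ring
  have hint : ∀ m : ℤ, IntegrableOn (fun x => 1 / 2 * Real.cos (m * (Real.pi / l) * x))
      (Ioo 0 l) := fun m =>
    (Continuous.integrableOn_Icc (by fun_prop)).mono_set Ioo_subset_Icc_self
  simp only [h]
  rw [integral_add (hint _) (hint _), integral_const_mul, integral_const_mul, integral_cos_int hl,
    integral_cos_int hl, if_neg (show ¬ ((i : ℤ) + j + 2 = 0) by omega)]
  by_cases hij : i = j
  · simp [hij]; ring
  · rw [if_neg hij, if_neg (by omega)]; simp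

theorem memLp_of_continuous {l : ℝ} {f : ℝ → ℝ} (hf : Continuous f) :
    MemLp f 2 (volume.restrict (Ioo 0 l)) := by
  obtain ⟨C, hC⟩ := (isCompact_Icc (a := 0) (b := l)).exists_bound_of_continuousOn hf.continuousOn
  refine MemLp.of_bound hf.aestronglyMeasurable C ?_
  filter_upwards [ae_restrict_mem measurableSet_Ioo] with x hx
  exact hC x (Ioo_subset_Icc_self hx)

theorem isH1_sin (l k : ℝ) :
    IsH1 l (fun x => Real.sin (k * x)) (fun x => k * Real.cos (k * x)) := by
  refine ⟨memLp_of_continuous (by fun_prop), fun x _ => ?_⟩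
  have h : ∀ t ∈ uIcc 0 x, HasDerivAt (fun x => Real.sin (k * x)) (k * Real.cos (k * t)) t := by
    intro t _
    have := (Real.hasDerivAt_sin (k * t)).comp t ((hasDerivAt_id t).const_mul k)
    simpa [mul_comm, Function.comp_def] using this
  rw [intervalIntegral.integral_eq_sub_of_hasDerivAt h (Continuous.intervalIntegrable
    (by fun_prop) _ _)]
  simp

end Interval

/-! ### Evaluation, Volterra and multiplication operators on an edge -/

section EdgeOperators

/-- The functional `g ↦ ∫₀ᵗ g` on `L²(0, l)`. -/
noncomputable def evalPrim (l t : ℝ) : Lp ℝ 2 (volume.restrict (Ioo (0 : ℝ) l)) →L[ℝ] ℝ :=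
  innerSL ℝ (indicatorConstLp 2 (measurableSet_Ioo (a := (0 : ℝ)) (b := t))
    (measure_ne_top _ _) (1 : ℝ))

theorem evalPrim_apply {l t : ℝ} (ht : t ∈ Icc 0 l)
    (g : Lp ℝ 2 (volume.restrict (Ioo (0 : ℝ) l))) :
    evalPrim l t g = ∫ s in (0 : ℝ)..t, g s := by
  unfold evalPrim
  rw [innerSL_apply_apply, L2.inner_indicatorConstLp_one,
    Measure.restrict_restrict measurableSet_Ioo,
    inter_eq_left.mpr (Ioo_subset_Ioo_right ht.2), integral_Ioo_eq_intervalIntegral ht.1]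

theorem abs_evalPrim_le (l t : ℝ) (g : Lp ℝ 2 (volume.restrict (Ioo (0 : ℝ) l))) :
    |evalPrim l t g| ≤ (volume.restrict (Ioo (0 : ℝ) l)).real univ ^ (1 / 2 : ℝ) * ‖g‖ := by
  unfold evalPrim
  rw [innerSL_apply_apply]
  refine (abs_real_inner_le_norm _ _).trans ?_
  gcongr
  refine norm_indicatorConstLp_le.trans ?_
  simp only [norm_one, one_mul, ENNReal.toReal_ofNat]
  gcongr
  · exact measure_ne_top _ _
  · exact subset_univ _

theorem intervalIntegral_congr_of_ae {l : ℝ} {f g : ℝ → ℝ}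
    (h : f =ᵐ[volume.restrict (Ioo (0 : ℝ) l)] g) {t : ℝ} (ht : t ∈ Icc 0 l) :
    ∫ s in (0 : ℝ)..t, f s = ∫ s in (0 : ℝ)..t, g s := by
  rw [← integral_Ioo_eq_intervalIntegral ht.1, ← integral_Ioo_eq_intervalIntegral ht.1]
  exact integral_congr_ae (ae_restrict_of_ae_restrict_of_subset (Ioo_subset_Ioo_right ht.2) h)

theorem memLp_primitive {l : ℝ} (g : Lp ℝ 2 (volume.restrict (Ioo (0 : ℝ) l))) :
    MemLp (fun x => ∫ t in (0 : ℝ)..x, g t) 2 (volume.restrict (Ioo 0 l)) := by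
  simpa using (IsH1.of_primitive (Lp.memLp g) 0).memLp

/-- The Volterra operator `g ↦ ∫₀ˣ g` on `L²(0, l)`. -/
noncomputable def primL (l : ℝ) : Lp ℝ 2 (volume.restrict (Ioo (0 : ℝ) l)) →L[ℝ]
    Lp ℝ 2 (volume.restrict (Ioo (0 : ℝ) l)) :=
  LinearMap.mkContinuous
    { toFun := fun g => (memLp_primitive g).toLp
      map_add' := fun f g => by
        rw [← MemLp.toLp_add]
        refine MemLp.toLp_congr _ _ ?_
        filter_upwards [ae_restrict_mem measurableSet_Ioo] with x hx
        have hx' := Ioo_subset_Icc_self hx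
        simp only [Pi.add_apply]
        rw [← evalPrim_apply hx', ← evalPrim_apply hx', ← evalPrim_apply hx', map_add]
      map_smul' := fun r g => by
        rw [RingHom.id_apply, ← MemLp.toLp_const_smul]
        refine MemLp.toLp_congr _ _ ?_
        filter_upwards [ae_restrict_mem measurableSet_Ioo] with x hx
        have hx' := Ioo_subset_Icc_self hx
        simp only [Pi.smul_apply]
        rw [← evalPrim_apply hx', ← evalPrim_apply hx', map_smul] }
    -- The second factor √l bounds the primitive uniformly in terms of `‖g‖`; the first passes from
    -- a uniform bound to the L² norm.
    (measureUnivNNReal (volume.restrict (Ioo (0 : ℝ) l)) ^ (2 : ENNReal).toReal⁻¹ *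
      (volume.restrict (Ioo (0 : ℝ) l)).real univ ^ (1 / 2 : ℝ)) (fun g => by
      rw [mul_assoc]
      refine Lp.norm_le_of_ae_bound (by positivity) ?_
      filter_upwards [(memLp_primitive g).coeFn_toLp, ae_restrict_mem measurableSet_Ioo]
        with x hx hm
      change ‖((memLp_primitive g).toLp : ℝ → ℝ) x‖ ≤ _
      rw [hx, ← evalPrim_apply (Ioo_subset_Icc_self hm)]
      exact abs_evalPrim_le l x g)

theorem primL_ae {l : ℝ} (g : Lp ℝ 2 (volume.restrict (Ioo (0 : ℝ) l))) :
    primL l g =ᵐ[volume.restrict (Ioo (0 : ℝ) l)] fun x => ∫ t in (0 : ℝ)..x, g t :=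
  (memLp_primitive g).coeFn_toLp

/-- Multiplication by a bounded function as an operator on `L²(0, l)`. -/
noncomputable def mulL {l : ℝ} (c : Lp ℝ ⊤ (volume.restrict (Ioo (0 : ℝ) l))) :
    Lp ℝ 2 (volume.restrict (Ioo (0 : ℝ) l)) →L[ℝ] Lp ℝ 2 (volume.restrict (Ioo (0 : ℝ) l)) :=
  (ContinuousLinearMap.mul ℝ ℝ).holderL (volume.restrict (Ioo (0 : ℝ) l)) ⊤ 2 2 c

theorem mulL_ae {l : ℝ} (c : Lp ℝ ⊤ (volume.restrict (Ioo (0 : ℝ) l)))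
    (g : Lp ℝ 2 (volume.restrict (Ioo (0 : ℝ) l))) :
    mulL c g =ᵐ[volume.restrict (Ioo (0 : ℝ) l)] fun x => c x * g x :=
  (ContinuousLinearMap.mul ℝ ℝ).coeFn_holder c g

end EdgeOperators

/-! ### The form space and form domain of a metric graph -/

namespace MetricGraph

variable {V : Type*} {G : SimpleGraph V}

theorem src_ne_tgt (Γ : MetricGraph G) (e : G.edgeSet) : Γ.src e ≠ Γ.tgt e := by
  have h := e.2
  rw [← Γ.ends e, SimpleGraph.mem_edgeSet] at h
  exact h.ne

theorem mem_edge_iff (Γ : MetricGraph G) (e : G.edgeSet) (v : V) :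
    v ∈ (e : Sym2 V) ↔ v = Γ.src e ∨ v = Γ.tgt e := by
  rw [← Γ.ends e, Sym2.mem_iff]

theorem coord_src (Γ : MetricGraph G) (e : G.edgeSet) : Γ.coord e (Γ.src e) = 0 := by
  simp [coord]

theorem coord_tgt (Γ : MetricGraph G) (e : G.edgeSet) : Γ.coord e (Γ.tgt e) = Γ.length e := by
  simp [coord, (Γ.src_ne_tgt e).symm]

theorem coord_mem (Γ : MetricGraph G) (e : G.edgeSet) (v : V) :
    Γ.coord e v ∈ Icc 0 (Γ.length e) := by
  unfold coord
  have := (Γ.length_pos e).le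
  split_ifs <;> simp [this]

/-- A function on the edges is continuous at the vertices if and only if its boundary values are
given by a function on the vertices. -/
theorem vertexContinuous_iff (Γ : MetricGraph G) (u : G.edgeSet → ℝ → ℝ) :
    Γ.VertexContinuous u ↔
      ∃ φ : V → ℝ, ∀ e, u e 0 = φ (Γ.src e) ∧ u e (Γ.length e) = φ (Γ.tgt e) := by
  classical
  constructor
  · intro h
    -- At an isolated vertex the value is arbitrary; 0 is taken.
    refine ⟨fun v => if hv : ∃ e : G.edgeSet, v ∈ (e : Sym2 V) then
      u hv.choose (Γ.coord hv.choose v) else 0, fun e => ?_⟩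
    have hs : ∃ e' : G.edgeSet, Γ.src e ∈ (e' : Sym2 V) := ⟨e, (Γ.mem_edge_iff e _).mpr (Or.inl rfl)⟩
    have ht : ∃ e' : G.edgeSet, Γ.tgt e ∈ (e' : Sym2 V) := ⟨e, (Γ.mem_edge_iff e _).mpr (Or.inr rfl)⟩
    constructor
    · simp only
      rw [dif_pos hs, ← h _ e hs.choose ((Γ.mem_edge_iff e _).mpr (Or.inl rfl)) hs.choose_spec,
        coord_src]
    · simp only
      rw [dif_pos ht, ← h _ e ht.choose ((Γ.mem_edge_iff e _).mpr (Or.inr rfl)) ht.choose_spec,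
        coord_tgt]
  · rintro ⟨φ, h⟩
    have key : ∀ (v : V) (e : G.edgeSet), v ∈ (e : Sym2 V) → u e (Γ.coord e v) = φ v := by
      intro v e hv
      rcases (Γ.mem_edge_iff e v).mp hv with rfl | rfl
      · rw [coord_src, (h e).1]
      · rw [coord_tgt, (h e).2]
    intro v e₁ e₂ h₁ h₂
    rw [key v e₁ h₁, key v e₂ h₂]

/-- The parametrization of `H¹` functions on the edges by their initial values and derivatives. -/
abbrev FormSpace (Γ : MetricGraph G) : Type _ :=
  WithLp 2 (EuclideanSpace ℝ G.edgeSet × Γ.StateSpace)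

/-- The `H¹` function parametrized by an element of the form space. -/
noncomputable def rep (Γ : MetricGraph G) (x : Γ.FormSpace) (e : G.edgeSet) (t : ℝ) : ℝ :=
  x.fst e + ∫ s in (0 : ℝ)..t, x.snd e s

theorem isH1_rep (Γ : MetricGraph G) (x : Γ.FormSpace) (e : G.edgeSet) :
    IsH1 (Γ.length e) (Γ.rep x e) (x.snd e) :=
  IsH1.of_primitive (Lp.memLp _) _

theorem rep_zero (Γ : MetricGraph G) (x : Γ.FormSpace) (e : G.edgeSet) :
    Γ.rep x e 0 = x.fst e := by
  simp [rep]

/-- Evaluation at a point of an edge. -/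
noncomputable def evalL (Γ : MetricGraph G) (e : G.edgeSet) (t : ℝ) : Γ.FormSpace →L[ℝ] ℝ :=
  EuclideanSpace.proj e ∘L WithLp.fstL 2 ℝ _ _ +
    (evalPrim (Γ.length e) t ∘L PiLp.proj 2 _ e) ∘L WithLp.sndL 2 ℝ _ _

theorem evalL_apply (Γ : MetricGraph G) (e : G.edgeSet) {t : ℝ} (ht : t ∈ Icc 0 (Γ.length e))
    (x : Γ.FormSpace) : Γ.evalL e t x = Γ.rep x e t := by
  unfold rep
  rw [← evalPrim_apply ht]
  rfl

/-- The form domain: the `H¹` functions that are continuous at the vertices. -/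
noncomputable def formDomain (Γ : MetricGraph G) : Submodule ℝ Γ.FormSpace :=
  ⨅ (v : V) (e₁ : G.edgeSet) (e₂ : G.edgeSet) (_ : v ∈ (e₁ : Sym2 V)) (_ : v ∈ (e₂ : Sym2 V)),
    LinearMap.ker
      ((Γ.evalL e₁ (Γ.coord e₁ v) - Γ.evalL e₂ (Γ.coord e₂ v) : Γ.FormSpace →L[ℝ] ℝ) :
        Γ.FormSpace →ₗ[ℝ] ℝ)

theorem mem_formDomain (Γ : MetricGraph G) (x : Γ.FormSpace) :
    x ∈ Γ.formDomain ↔ Γ.VertexContinuous (Γ.rep x) := by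
  simp only [formDomain, Submodule.mem_iInf, LinearMap.mem_ker, VertexContinuous,
    ContinuousLinearMap.coe_coe, _root_.sub_apply, sub_eq_zero, Γ.evalL_apply _ (Γ.coord_mem _ _)]

theorem isClosed_formDomain (Γ : MetricGraph G) : IsClosed (Γ.formDomain : Set Γ.FormSpace) := by
  simp only [formDomain, Submodule.coe_iInf]
  refine isClosed_iInter fun v => isClosed_iInter fun e₁ => isClosed_iInter fun e₂ =>
    isClosed_iInter fun _ => isClosed_iInter fun _ => ?_
  exact (Γ.evalL e₁ (Γ.coord e₁ v) - Γ.evalL e₂ (Γ.coord e₂ v)).isClosed_ker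

/-- Assembling a function on the graph from its restrictions to the edges. -/
noncomputable def ofEdges (Γ : MetricGraph G) :
    (∀ e : G.edgeSet, Lp ℝ 2 (volume.restrict (Ioo (0 : ℝ) (Γ.length e)))) →L[ℝ] Γ.StateSpace :=
  (PiLp.continuousLinearEquiv 2 ℝ fun e : G.edgeSet =>
    Lp ℝ 2 (volume.restrict (Ioo (0 : ℝ) (Γ.length e)))).symm.toContinuousLinearMap

/-- The direct sum of operators on the edges. -/
noncomputable def diagMap (Γ : MetricGraph G)
    (T : ∀ e : G.edgeSet, Lp ℝ 2 (volume.restrict (Ioo (0 : ℝ) (Γ.length e))) →L[ℝ]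
      Lp ℝ 2 (volume.restrict (Ioo (0 : ℝ) (Γ.length e)))) : Γ.StateSpace →L[ℝ] Γ.StateSpace :=
  Γ.ofEdges ∘L
    ContinuousLinearMap.pi fun e => T e ∘L PiLp.proj 2 _ e

theorem diagMap_apply (Γ : MetricGraph G)
    (T : ∀ e : G.edgeSet, Lp ℝ 2 (volume.restrict (Ioo (0 : ℝ) (Γ.length e))) →L[ℝ]
      Lp ℝ 2 (volume.restrict (Ioo (0 : ℝ) (Γ.length e)))) (f : Γ.StateSpace) (e : G.edgeSet) :
    Γ.diagMap T f e = T e (f e) := rfl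

/-- The functions that are constant on every edge. -/
noncomputable def constMap (Γ : MetricGraph G) : EuclideanSpace ℝ G.edgeSet →L[ℝ] Γ.StateSpace :=
  Γ.ofEdges ∘L
    ContinuousLinearMap.pi fun e =>
      Lp.constL 2 (volume.restrict (Ioo (0 : ℝ) (Γ.length e))) ℝ ∘L EuclideanSpace.proj e

theorem constMap_injective (Γ : MetricGraph G) : Function.Injective Γ.constMap := by
  intro a b hab
  ext e
  have h : Lp.const 2 (volume.restrict (Ioo 0 (Γ.length e))) (a e) =
      Lp.const 2 (volume.restrict (Ioo 0 (Γ.length e))) (b e) :=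
    congrFun (congrArg WithLp.ofLp hab) e
  have h1 := Lp.coeFn_const (μ := volume.restrict (Ioo 0 (Γ.length e))) (p := 2) (c := a e)
  have h2 := Lp.coeFn_const (μ := volume.restrict (Ioo 0 (Γ.length e))) (p := 2) (c := b e)
  rw [h] at h1
  have h3 := h1.symm.trans h2
  have : NeZero (volume.restrict (Ioo 0 (Γ.length e))) :=
    ⟨by
      rw [Ne, Measure.restrict_eq_zero]
      simp [Γ.length_pos e]⟩
  obtain ⟨t, ht⟩ := h3.exists
  exact ht

variable [Fintype G.edgeSet]

/-- The boundary terms of an integration by parts, sorted by vertices. -/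
theorem sum_boundary [Fintype V] (Γ : MetricGraph G) (c u' : G.edgeSet → ℝ → ℝ) (φ : V → ℝ) :
    ∑ e, (c e (Γ.length e) * u' e (Γ.length e) * φ (Γ.tgt e) - c e 0 * u' e 0 * φ (Γ.src e)) =
      open Classical in
      -∑ v, φ v * ∑ e ∈ Finset.univ.filter (fun e : G.edgeSet => v ∈ (e : Sym2 V)),
        c e (Γ.coord e v) * Γ.outwardDeriv e v (u' e) := by
  classical
  simp only [Finset.mul_sum, Finset.sum_filter]
  rw [Finset.sum_comm, ← Finset.sum_neg_distrib]
  refine Finset.sum_congr rfl fun e _ => ?_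
  have hne := Γ.src_ne_tgt e
  -- An edge contributes at its two ends only, and these are distinct because the graph has no
  -- loops.
  have h : ∀ v, φ v * (if v ∈ (e : Sym2 V) then
        c e (Γ.coord e v) * Γ.outwardDeriv e v (u' e) else 0) =
      (if v = Γ.src e then φ (Γ.src e) * (c e 0 * u' e 0) else 0) +
      (if v = Γ.tgt e then φ (Γ.tgt e) * (c e (Γ.length e) * -u' e (Γ.length e)) else 0) := by
    intro v
    rw [mul_ite, mul_zero]
    simp only [Γ.mem_edge_iff e v]
    by_cases h1 : v = Γ.src e
    · subst h1
      simp [hne, coord_src, outwardDeriv]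
    · by_cases h2 : v = Γ.tgt e
      · subst h2
        simp [hne.symm, coord_tgt, outwardDeriv]
      · simp [h1, h2]
  simp only [h, Finset.sum_add_distrib, Finset.sum_ite_eq', Finset.mem_univ, if_true]
  ring

/-- The embedding of the form space into the state space. -/
noncomputable def embed (Γ : MetricGraph G) : Γ.FormSpace →L[ℝ] Γ.StateSpace :=
  Γ.constMap ∘L WithLp.fstL 2 ℝ _ _ +
    Γ.diagMap (fun e => primL (Γ.length e)) ∘L WithLp.sndL 2 ℝ _ _

theorem embed_ae (Γ : MetricGraph G) (x : Γ.FormSpace) (e : G.edgeSet) :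
    Γ.embed x e =ᵐ[volume.restrict (Ioo 0 (Γ.length e))] Γ.rep x e := by
  have h : Γ.embed x e = Lp.const 2 _ (x.fst e) + primL (Γ.length e) (x.snd e) := rfl
  rw [h]
  filter_upwards [Lp.coeFn_add (Lp.const 2 (volume.restrict (Ioo 0 (Γ.length e))) (x.fst e))
    (primL (Γ.length e) (x.snd e)), primL_ae (x.snd e),
    Lp.coeFn_const (μ := volume.restrict (Ioo 0 (Γ.length e))) (p := 2) (c := x.fst e)]
    with t h1 h2 h3
  rw [h1, Pi.add_apply, h2, h3]
  rfl

/-- The initial values are the only part of the norm not visible on the right. They form a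
finite-dimensional space on which `constMap` is injective, hence bounded below, and the edgewise
constants are u minus the primitives of u'. This gives coercivity of the form plus the inner
product. -/
theorem exists_norm_le (Γ : MetricGraph G) :
    ∃ C > 0, ∀ x : Γ.FormSpace, ‖x‖ ≤ C * (‖x.snd‖ + ‖Γ.embed x‖) := by
  obtain ⟨K, hK, hanti⟩ := (Γ.constMap : EuclideanSpace ℝ G.edgeSet →ₗ[ℝ]
    Γ.StateSpace).exists_antilipschitzWith (LinearMap.ker_eq_bot.mpr Γ.constMap_injective)
  let I : Γ.StateSpace →L[ℝ] Γ.StateSpace := Γ.diagMap fun e => primL (Γ.length e)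
  have hfst : ∀ x : Γ.FormSpace, ‖x.fst‖ ≤ K * (‖Γ.embed x‖ + ‖I‖ * ‖x.snd‖) := by
    intro x
    have h1 : ‖x.fst‖ ≤ K * ‖Γ.constMap x.fst‖ := by
      simpa using hanti.le_mul_dist x.fst 0
    have h2 : Γ.constMap x.fst = Γ.embed x - I x.snd := by
      rw [eq_sub_iff_add_eq]
      rfl
    rw [h2] at h1
    refine h1.trans ?_
    gcongr
    exact (norm_sub_le _ _).trans (by gcongr; exact I.le_opNorm _)
  refine ⟨K * (1 + ‖I‖) + 1, by positivity, fun x => ?_⟩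
  have hx : ‖x‖ ≤ ‖x.fst‖ + ‖x.snd‖ := by
    have h := WithLp.prod_norm_sq_eq_of_L2 x
    refine abs_le_of_sq_le_sq' ?_ (by positivity) |>.2
    nlinarith [mul_nonneg (norm_nonneg x.fst) (norm_nonneg x.snd)]
  have h1 := hfst x
  have hK' : (0 : ℝ) ≤ K := K.2
  have h2 : 0 ≤ (K : ℝ) * ‖I‖ * ‖Γ.embed x‖ := by positivity
  have h3 : 0 ≤ (K : ℝ) * ‖x.snd‖ := by positivity
  nlinarith [norm_nonneg (Γ.embed x)]

end MetricGraph

/-! ### The form, Green's formula, and weak versus strong solutions -/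

namespace MetricGraph

variable {V : Type*} {G : SimpleGraph V} [Fintype G.edgeSet]

theorem inner_eq_sum (Γ : MetricGraph G) (f g : Γ.StateSpace) :
    inner ℝ f g = ∑ e, ∫ t in Ioo 0 (Γ.length e), f e t * g e t := by
  rw [PiLp.inner_apply]
  refine Finset.sum_congr rfl fun e _ => ?_
  rw [L2.inner_def]
  refine integral_congr_ae (Filter.Eventually.of_forall fun t => ?_)
  simp [mul_comm]

theorem norm_sq_eq_sum (Γ : MetricGraph G) (f : Γ.StateSpace) :
    ‖f‖ ^ 2 = ∑ e, ∫ t in Ioo 0 (Γ.length e), f e t ^ 2 := by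
  rw [← real_inner_self_eq_norm_sq, inner_eq_sum]
  simp only [sq]

theorem inner_embed (Γ : MetricGraph G) (f : Γ.StateSpace) (y : Γ.FormSpace) :
    inner ℝ f (Γ.embed y) = ∑ e, ∫ t in Ioo 0 (Γ.length e), f e t * Γ.rep y e t := by
  rw [inner_eq_sum]
  refine Finset.sum_congr rfl fun e _ => integral_congr_ae ?_
  filter_upwards [Γ.embed_ae y e] with t ht
  rw [ht]

theorem inner_embed_embed (Γ : MetricGraph G) (x y : Γ.FormSpace) :
    inner ℝ (Γ.embed x) (Γ.embed y) =
      ∑ e, ∫ t in Ioo 0 (Γ.length e), Γ.rep x e t * Γ.rep y e t := by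
  rw [inner_embed]
  refine Finset.sum_congr rfl fun e _ => integral_congr_ae ?_
  filter_upwards [Γ.embed_ae x e] with t ht
  rw [ht]

/-- The form `∑ₑ ∫ c u' v' + p u v` on the form space. -/
noncomputable def form (Γ : MetricGraph G)
    (C P : ∀ e : G.edgeSet, Lp ℝ ⊤ (volume.restrict (Ioo (0 : ℝ) (Γ.length e)))) :
    Γ.FormSpace →L[ℝ] Γ.FormSpace →L[ℝ] ℝ :=
  (innerBilin Γ.StateSpace).bilinearComp (Γ.diagMap (fun e => mulL (C e)) ∘L WithLp.sndL 2 ℝ _ _)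
    (WithLp.sndL 2 ℝ _ _) +
  (innerBilin Γ.StateSpace).bilinearComp (Γ.diagMap (fun e => mulL (P e)) ∘L Γ.embed) Γ.embed

section Form

variable (Γ : MetricGraph G)
  (C P : ∀ e : G.edgeSet, Lp ℝ ⊤ (volume.restrict (Ioo (0 : ℝ) (Γ.length e))))

theorem form_apply (x y : Γ.FormSpace) :
    Γ.form C P x y = inner ℝ (Γ.diagMap (fun e => mulL (C e)) x.snd) y.snd +
      inner ℝ (Γ.diagMap (fun e => mulL (P e)) (Γ.embed x)) (Γ.embed y) := rfl

theorem form_eq_sum (x y : Γ.FormSpace) :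
    Γ.form C P x y = ∑ e, ((∫ t in Ioo 0 (Γ.length e), C e t * x.snd e t * y.snd e t) +
      ∫ t in Ioo 0 (Γ.length e), P e t * Γ.rep x e t * Γ.rep y e t) := by
  rw [form_apply, inner_eq_sum, inner_embed, ← Finset.sum_add_distrib]
  refine Finset.sum_congr rfl fun e _ => ?_
  congr 1
  · refine integral_congr_ae ?_
    filter_upwards [mulL_ae (C e) (x.snd e)] with t ht
    rw [diagMap_apply, ht]
  · refine integral_congr_ae ?_
    filter_upwards [mulL_ae (P e) (Γ.embed x e), Γ.embed_ae x e] with t ht h2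
    rw [diagMap_apply, ht, h2]

theorem form_symm (x y : Γ.FormSpace) : Γ.form C P x y = Γ.form C P y x := by
  rw [form_eq_sum, form_eq_sum]
  refine Finset.sum_congr rfl fun e _ => ?_
  congr 1 <;> exact integral_congr_ae (Filter.Eventually.of_forall fun t => by ring)

theorem integrable_mul_mul {l : ℝ} (c : Lp ℝ ⊤ (volume.restrict (Ioo (0 : ℝ) l)))
    {f g : ℝ → ℝ} (hf : MemLp f 2 (volume.restrict (Ioo 0 l)))
    (hg : MemLp g 2 (volume.restrict (Ioo 0 l))) :
    IntegrableOn (fun t => c t * f t * g t) (Ioo 0 l) := by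
  have h : MemLp (fun t => c t * f t) 2 (volume.restrict (Ioo 0 l)) := hf.mul (Lp.memLp c)
  exact h.integrable_mul hg

theorem le_form {c₀ : ℝ}
    (hC : ∀ e, ∀ᵐ t ∂(volume.restrict (Ioo 0 (Γ.length e))), c₀ ≤ C e t)
    (hP : ∀ e, ∀ᵐ t ∂(volume.restrict (Ioo 0 (Γ.length e))), 0 ≤ P e t) (x : Γ.FormSpace) :
    c₀ * ‖x.snd‖ ^ 2 ≤ Γ.form C P x x := by
  rw [form_eq_sum, norm_sq_eq_sum, Finset.mul_sum]
  refine Finset.sum_le_sum fun e _ => ?_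
  have h1 : 0 ≤ ∫ t in Ioo 0 (Γ.length e), P e t * Γ.rep x e t * Γ.rep x e t := by
    refine integral_nonneg_of_ae ?_
    filter_upwards [hP e] with t ht
    change 0 ≤ P e t * Γ.rep x e t * Γ.rep x e t
    rw [mul_assoc]
    exact mul_nonneg ht (mul_self_nonneg _)
  have h2 : c₀ * ∫ t in Ioo 0 (Γ.length e), x.snd e t ^ 2 ≤
      ∫ t in Ioo 0 (Γ.length e), C e t * x.snd e t * x.snd e t := by
    rw [← integral_const_mul]
    refine integral_mono_ae ((Lp.memLp _).integrable_sq.const_mul _)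
      (integrable_mul_mul (C e) (Lp.memLp _) (Lp.memLp _)) ?_
    filter_upwards [hC e] with t ht
    rw [mul_assoc, sq]
    exact mul_le_mul_of_nonneg_right ht (mul_self_nonneg _)
  linarith

theorem form_le : ∃ K ≥ 0, ∀ x : Γ.FormSpace,
    Γ.form C P x x ≤ K * (‖x.snd‖ ^ 2 + ‖Γ.embed x‖ ^ 2) := by
  set M := Γ.diagMap fun e => mulL (C e)
  set N := Γ.diagMap fun e => mulL (P e)
  refine ⟨‖M‖ + ‖N‖, by positivity, fun x => ?_⟩
  rw [form_apply]
  have h : ∀ (T : Γ.StateSpace →L[ℝ] Γ.StateSpace) f, inner ℝ (T f) f ≤ ‖T‖ * ‖f‖ ^ 2 := by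
    intro T f
    refine (real_inner_le_norm _ _).trans ?_
    rw [sq, ← mul_assoc]
    gcongr
    exact T.le_opNorm f
  have h1 := h M x.snd
  have h2 := h N (Γ.embed x)
  have h3 : 0 ≤ ‖M‖ * ‖Γ.embed x‖ ^ 2 := by positivity
  have h4 : 0 ≤ ‖N‖ * ‖x.snd‖ ^ 2 := by positivity
  linarith

variable {C P} {c p : G.edgeSet → ℝ → ℝ}

/-- Green's formula. -/
theorem form_eq_boundary [Fintype V]
    (hC : ∀ e, C e =ᵐ[volume.restrict (Ioo 0 (Γ.length e))] c e)
    (hP : ∀ e, P e =ᵐ[volume.restrict (Ioo 0 (Γ.length e))] p e)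
    {x : Γ.FormSpace} {h : Γ.StateSpace} {u' w w' : G.edgeSet → ℝ → ℝ}
    (hx : ∀ e, x.snd e =ᵐ[volume.restrict (Ioo 0 (Γ.length e))] u' e)
    (hw : ∀ e, IsH1 (Γ.length e) (w e) (w' e))
    (hwc : ∀ e, ∀ t ∈ Icc 0 (Γ.length e), w e t = c e t * u' e t)
    (hh : ∀ e, h e =ᵐ[volume.restrict (Ioo 0 (Γ.length e))]
      fun t => w' e t - p e t * Γ.rep x e t)
    {y : Γ.FormSpace} {φ : V → ℝ}
    (hy : ∀ e, Γ.rep y e 0 = φ (Γ.src e) ∧ Γ.rep y e (Γ.length e) = φ (Γ.tgt e)) :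
    Γ.form C P x y = -inner ℝ h (Γ.embed y) -
      open Classical in
      ∑ v, φ v * ∑ e ∈ Finset.univ.filter (fun e : G.edgeSet => v ∈ (e : Sym2 V)),
        c e (Γ.coord e v) * Γ.outwardDeriv e v (u' e) := by
  rw [sub_eq_add_neg, ← Γ.sum_boundary c u' φ, inner_embed, form_eq_sum,
    ← Finset.sum_neg_distrib, ← Finset.sum_add_distrib]
  refine Finset.sum_congr rfl fun e _ => ?_
  have hl := Γ.length_pos e
  have hY := Γ.isH1_rep y e
  have h1 : ∫ t in Ioo 0 (Γ.length e), C e t * x.snd e t * y.snd e t =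
      ∫ t in Ioo 0 (Γ.length e), w e t * y.snd e t := by
    refine integral_congr_ae ?_
    filter_upwards [hC e, hx e, ae_restrict_mem measurableSet_Ioo] with t h1 h2 h3
    rw [h1, h2, hwc e t (Ioo_subset_Icc_self h3)]
  have h2 : ∫ t in Ioo 0 (Γ.length e), h e t * Γ.rep y e t =
      (∫ t in Ioo 0 (Γ.length e), w' e t * Γ.rep y e t) -
        ∫ t in Ioo 0 (Γ.length e), P e t * Γ.rep x e t * Γ.rep y e t := by
    have hi : IntegrableOn (fun t => w' e t * Γ.rep y e t) (Ioo 0 (Γ.length e)) :=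
      (hw e).1.integrable_mul hY.memLp
    rw [← integral_sub hi (integrable_mul_mul (P e) (Γ.isH1_rep x e).memLp hY.memLp)]
    refine integral_congr_ae ?_
    filter_upwards [hh e, hP e] with t h1 h2
    rw [h1, h2]
    ring
  rw [h1, h2, (hw e).integral_mul_deriv hl hY, hwc e 0 (left_mem_Icc.mpr hl.le),
    hwc e _ (right_mem_Icc.mpr hl.le), (hy e).1, (hy e).2]
  ring

/-- Strong solutions are weak solutions: in Green's formula the boundary terms at a vertex share the
factor `φ v`, and what multiplies it is the Kirchhoff sum. -/
theorem exists_form_of_operatorRel [Fintype V]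
    (hC : ∀ e, C e =ᵐ[volume.restrict (Ioo 0 (Γ.length e))] c e)
    (hP : ∀ e, P e =ᵐ[volume.restrict (Ioo 0 (Γ.length e))] p e)
    {f h : Γ.StateSpace} (H : Γ.OperatorRel c p f h) :
    ∃ x ∈ Γ.formDomain, Γ.embed x = f ∧
      ∀ y ∈ Γ.formDomain, Γ.form C P x y = -inner ℝ h (Γ.embed y) := by
  obtain ⟨u, u', w, w', hf, hu, hw, hwc, huv, hK, hh⟩ := H
  let x : Γ.FormSpace := WithLp.toLp 2
    (WithLp.toLp 2 fun e => u e 0, WithLp.toLp 2 fun e => (hu e).1.toLp)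
  have hx : ∀ e, x.snd e =ᵐ[volume.restrict (Ioo 0 (Γ.length e))] u' e :=
    fun e => (hu e).1.coeFn_toLp
  have hrep : ∀ e, ∀ t ∈ Icc 0 (Γ.length e), Γ.rep x e t = u e t := by
    intro e t ht
    rw [(hu e).2 t ht, ← intervalIntegral_congr_of_ae (hx e) ht]
    rfl
  have hrepo : ∀ e, ∀ᵐ t ∂(volume.restrict (Ioo 0 (Γ.length e))), Γ.rep x e t = u e t := by
    intro e
    filter_upwards [ae_restrict_mem measurableSet_Ioo] with t ht
    exact hrep e t (Ioo_subset_Icc_self ht)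
  refine ⟨x, ?_, ?_, fun y hy => ?_⟩
  · rw [mem_formDomain]
    intro v e₁ e₂ h₁ h₂
    rw [hrep _ _ (Γ.coord_mem _ _), hrep _ _ (Γ.coord_mem _ _)]
    exact huv v e₁ e₂ h₁ h₂
  · ext1 e
    refine Lp.ext ?_
    filter_upwards [Γ.embed_ae x e, hf e, hrepo e] with t h1 h2 h3
    rw [h1, h2, h3]
  · obtain ⟨φ, hφ⟩ := (Γ.vertexContinuous_iff _).mp ((Γ.mem_formDomain y).mp hy)
    rw [Γ.form_eq_boundary hC hP hx hw hwc ?_ hφ]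
    · rw [Finset.sum_eq_zero, sub_zero]
      intro v _
      rw [hK v, mul_zero]
    · intro e
      filter_upwards [hh e, hrepo e] with t h1 h2
      rw [h1, h2]

/-- The element of the form space whose derivative is supported on one edge and that vanishes at
the origin of every edge. -/
noncomputable def edgeFun (e : G.edgeSet)
    (g : Lp ℝ 2 (volume.restrict (Ioo (0 : ℝ) (Γ.length e)))) : Γ.FormSpace :=
  open Classical in WithLp.toLp 2 (0, PiLp.single 2 e g)

omit [Fintype G.edgeSet] in
theorem edgeFun_snd_same (e : G.edgeSet)
    (g : Lp ℝ 2 (volume.restrict (Ioo (0 : ℝ) (Γ.length e)))) :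
    (Γ.edgeFun e g).snd e = g := by
  classical
  exact PiLp.single_eq_same _ _ _

omit [Fintype G.edgeSet] in
theorem edgeFun_snd_of_ne {e e' : G.edgeSet} (h : e' ≠ e)
    (g : Lp ℝ 2 (volume.restrict (Ioo (0 : ℝ) (Γ.length e)))) :
    (Γ.edgeFun e g).snd e' = 0 := by
  classical
  exact PiLp.single_eq_of_ne _ h _

omit [Fintype G.edgeSet] in
theorem rep_edgeFun_same (e : G.edgeSet)
    (g : Lp ℝ 2 (volume.restrict (Ioo (0 : ℝ) (Γ.length e)))) (t : ℝ) :
    Γ.rep (Γ.edgeFun e g) e t = ∫ s in (0 : ℝ)..t, g s := by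
  rw [rep, edgeFun_snd_same]
  simp [edgeFun]

omit [Fintype G.edgeSet] in
theorem rep_edgeFun_of_ne {e e' : G.edgeSet} (h : e' ≠ e)
    (g : Lp ℝ 2 (volume.restrict (Ioo (0 : ℝ) (Γ.length e)))) {t : ℝ}
    (ht : t ∈ Icc 0 (Γ.length e')) : Γ.rep (Γ.edgeFun e g) e' t = 0 := by
  rw [rep, edgeFun_snd_of_ne Γ h, intervalIntegral_congr_of_ae (Lp.coeFn_zero _ _ _) ht]
  simp [edgeFun]

omit [Fintype G.edgeSet] in
theorem edgeFun_boundary {e : G.edgeSet}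
    {g : Lp ℝ 2 (volume.restrict (Ioo (0 : ℝ) (Γ.length e)))}
    (hg : ∫ s in (0 : ℝ)..Γ.length e, g s = 0) (e' : G.edgeSet) :
    Γ.rep (Γ.edgeFun e g) e' 0 = 0 ∧ Γ.rep (Γ.edgeFun e g) e' (Γ.length e') = 0 := by
  have hl := (Γ.length_pos e').le
  by_cases h : e' = e
  · subst h
    rw [rep_edgeFun_same, rep_edgeFun_same, hg]
    simp
  · rw [rep_edgeFun_of_ne Γ h g (left_mem_Icc.mpr hl), rep_edgeFun_of_ne Γ h g (right_mem_Icc.mpr hl)]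
    simp

omit [Fintype G.edgeSet] in
theorem edgeFun_mem_formDomain {e : G.edgeSet}
    {g : Lp ℝ 2 (volume.restrict (Ioo (0 : ℝ) (Γ.length e)))}
    (hg : ∫ s in (0 : ℝ)..Γ.length e, g s = 0) : Γ.edgeFun e g ∈ Γ.formDomain := by
  rw [mem_formDomain, vertexContinuous_iff]
  exact ⟨0, Γ.edgeFun_boundary hg⟩

/-- Weak solutions are strong solutions. -/
theorem operatorRel_of_form [Fintype V]
    (hC : ∀ e, C e =ᵐ[volume.restrict (Ioo 0 (Γ.length e))] c e)
    (hP : ∀ e, P e =ᵐ[volume.restrict (Ioo 0 (Γ.length e))] p e)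
    (hc : ∀ e, ∀ t ∈ Icc 0 (Γ.length e), c e t ≠ 0)
    {x : Γ.FormSpace} (hx : x ∈ Γ.formDomain) {h : Γ.StateSpace}
    (H : ∀ y ∈ Γ.formDomain, Γ.form C P x y = -inner ℝ h (Γ.embed y)) :
    Γ.OperatorRel c p (Γ.embed x) h := by
  classical
  let w' : G.edgeSet → ℝ → ℝ := fun e t => h e t + P e t * Γ.rep x e t
  have hw' : ∀ e, MemLp (w' e) 2 (volume.restrict (Ioo 0 (Γ.length e))) := fun e =>
    (Lp.memLp (h e)).add ((Γ.isH1_rep x e).memLp.mul (Lp.memLp (P e)))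
  have hcg : ∀ e, MemLp (fun t => C e t * x.snd e t) 2 (volume.restrict (Ioo 0 (Γ.length e))) :=
    fun e => (Lp.memLp (x.snd e)).mul (Lp.memLp (C e))
  -- Test functions living on one edge, whose derivative φ has mean zero so that they vanish at both
  -- ends, show that c u' minus the primitive of `w'` is orthogonal to every such φ, hence constant.
  have hflux : ∀ e, ∃ m : ℝ, (fun t => C e t * x.snd e t - (0 + ∫ s in (0 : ℝ)..t, w' e s))
      =ᵐ[volume.restrict (Ioo 0 (Γ.length e))] fun _ => m := by
    intro e
    have hl := Γ.length_pos e
    have hW := IsH1.of_primitive (hw' e) 0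
    refine exists_ae_eq_const hl ((hcg e).sub hW.memLp) fun φ hφ hφ0 => ?_
    set g := hφ.toLp with hg
    have hgφ := hφ.coeFn_toLp
    have hg0 : ∫ s in (0 : ℝ)..Γ.length e, g s = 0 := by
      rw [intervalIntegral_congr_of_ae hgφ (right_mem_Icc.mpr hl.le),
        ← integral_Ioo_eq_intervalIntegral hl.le, hφ0]
    have h1 := H _ (Γ.edgeFun_mem_formDomain hg0)
    rw [form_eq_sum, inner_embed, ← Finset.sum_neg_distrib] at h1
    have hY := Γ.isH1_rep (Γ.edgeFun e g) e
    rw [edgeFun_snd_same] at hY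
    have hother : ∀ e' ≠ e, ∀ F : ℝ → ℝ,
        ∫ t in Ioo 0 (Γ.length e'), F t * Γ.rep (Γ.edgeFun e g) e' t = 0 := by
      intro e' he' F
      refine setIntegral_eq_zero_of_forall_eq_zero fun t ht => ?_
      rw [rep_edgeFun_of_ne Γ he' g (Ioo_subset_Icc_self ht), mul_zero]
    rw [Finset.sum_eq_single e, Finset.sum_eq_single e] at h1
    · rw [edgeFun_snd_same] at h1
      have h2 := hW.integral_mul_deriv hl hY
      rw [(Γ.edgeFun_boundary hg0 e).1, (Γ.edgeFun_boundary hg0 e).2] at h2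
      have h3 : ∫ t in Ioo 0 (Γ.length e), w' e t * Γ.rep (Γ.edgeFun e g) e t =
          (∫ t in Ioo 0 (Γ.length e), h e t * Γ.rep (Γ.edgeFun e g) e t) +
          ∫ t in Ioo 0 (Γ.length e), P e t * Γ.rep x e t * Γ.rep (Γ.edgeFun e g) e t := by
        have hi : IntegrableOn (fun t => h e t * Γ.rep (Γ.edgeFun e g) e t)
          (Ioo 0 (Γ.length e)) := (Lp.memLp (h e)).integrable_mul hY.memLp
        rw [← integral_add hi (integrable_mul_mul (P e) (Γ.isH1_rep x e).memLp hY.memLp)]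
        exact integral_congr_ae (Filter.Eventually.of_forall fun t => by
          simp only [w']
          ring)
      have hi1 : IntegrableOn (fun t => C e t * x.snd e t * g t) (Ioo 0 (Γ.length e)) :=
        (hcg e).integrable_mul hY.1
      have hi2 : IntegrableOn (fun t => (0 + ∫ s in (0 : ℝ)..t, w' e s) * g t)
        (Ioo 0 (Γ.length e)) := hW.memLp.integrable_mul hY.1
      have h4 : ∫ t in Ioo 0 (Γ.length e),
          (C e t * x.snd e t - (0 + ∫ s in (0 : ℝ)..t, w' e s)) * φ t =
          (∫ t in Ioo 0 (Γ.length e), C e t * x.snd e t * g t) -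
          ∫ t in Ioo 0 (Γ.length e), (0 + ∫ s in (0 : ℝ)..t, w' e s) * g t := by
        rw [← integral_sub hi1 hi2]
        refine integral_congr_ae ?_
        filter_upwards [hgφ] with t ht
        rw [ht]
        ring
      refine h4.trans ?_
      rw [h2, h3]
      linarith
    · intro e' _ he'
      rw [hother e' he', neg_zero]
    · simp
    · intro e' _ he'
      rw [hother e' he', add_zero, edgeFun_snd_of_ne Γ he']
      refine integral_eq_zero_of_ae ?_
      filter_upwards [Lp.coeFn_zero ℝ 2 (volume.restrict (Ioo (0 : ℝ) (Γ.length e')))] with t ht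
      rw [ht]
      simp
    · simp
  choose m hm using hflux
  let w : G.edgeSet → ℝ → ℝ := fun e t => m e + ∫ s in (0 : ℝ)..t, w' e s
  have hw : ∀ e, IsH1 (Γ.length e) (w e) (w' e) := fun e => IsH1.of_primitive (hw' e) (m e)
  -- An L² class has no values at the vertices. Dividing the continuous flux by c selects the
  -- representative for which w = c u' holds at every point, so that the Kirchhoff sums are
  -- meaningful.
  let u' : G.edgeSet → ℝ → ℝ := fun e t => w e t / c e t
  have hwc : ∀ e, ∀ t ∈ Icc 0 (Γ.length e), w e t = c e t * u' e t := by
    intro e t ht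
    have := hc e t ht
    simp only [u']
    field_simp
  have hxu : ∀ e, x.snd e =ᵐ[volume.restrict (Ioo 0 (Γ.length e))] u' e := by
    intro e
    filter_upwards [hm e, hC e, ae_restrict_mem measurableSet_Ioo] with t h1 h2 h3
    have h4 := hc e t (Ioo_subset_Icc_self h3)
    simp only [u', w]
    rw [eq_div_iff h4, ← h1, ← h2]
    ring
  have hh : ∀ e, h e =ᵐ[volume.restrict (Ioo 0 (Γ.length e))]
      fun t => w' e t - p e t * Γ.rep x e t := by
    intro e
    filter_upwards [hP e] with t ht
    simp only [w']
    rw [ht]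
    ring
  refine ⟨Γ.rep x, u', w, w', Γ.embed_ae x, fun e => ⟨(memLp_congr_ae (hxu e)).mp (Lp.memLp _),
    fun t ht => ?_⟩, hw, hwc, (Γ.mem_formDomain x).mp hx, fun v => ?_, hh⟩
  · rw [← intervalIntegral_congr_of_ae (hxu e) ht, rep_zero]
    rfl
  -- The test function that is affine on every edge, 1 at v and 0 at all other vertices, isolates
  -- the Kirchhoff sum at v.
  · let φ : V → ℝ := Pi.single v 1
    let y : Γ.FormSpace := WithLp.toLp 2 (WithLp.toLp 2 fun e => φ (Γ.src e),
      WithLp.toLp 2 fun e => Lp.const 2 (volume.restrict (Ioo (0 : ℝ) (Γ.length e)))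
        ((φ (Γ.tgt e) - φ (Γ.src e)) / Γ.length e))
    have hy : ∀ e, Γ.rep y e 0 = φ (Γ.src e) ∧ Γ.rep y e (Γ.length e) = φ (Γ.tgt e) := by
      intro e
      have hl := Γ.length_pos e
      refine ⟨Γ.rep_zero y e, ?_⟩
      have h1 : Γ.rep y e (Γ.length e) = φ (Γ.src e) + ∫ s in (0 : ℝ)..Γ.length e,
        (Lp.const 2 (volume.restrict (Ioo (0 : ℝ) (Γ.length e)))
          ((φ (Γ.tgt e) - φ (Γ.src e)) / Γ.length e)) s := rfl
      rw [h1, intervalIntegral_congr_of_ae (Lp.coeFn_const 2 _ _) (right_mem_Icc.mpr hl.le)]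
      simp only [Function.const_apply, intervalIntegral.integral_const, smul_eq_mul]
      field_simp
      ring
    have hyd : y ∈ Γ.formDomain := by
      rw [mem_formDomain, vertexContinuous_iff]
      exact ⟨φ, hy⟩
    have h1 := Γ.form_eq_boundary hC hP hxu hw hwc hh hy
    rw [H y hyd] at h1
    have h2 : ∑ v', φ v' * ∑ e ∈ Finset.univ.filter (fun e : G.edgeSet => v' ∈ (e : Sym2 V)),
        c e (Γ.coord e v') * Γ.outwardDeriv e v' (u' e) = 0 := by
      convert (sub_eq_self.mp h1.symm)
    rw [Finset.sum_eq_single v (fun v' _ hv' => by simp [φ, hv']) (by simp)] at h2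
    simp only [φ, Pi.single_eq_same, one_mul] at h2
    convert h2

end Form

end MetricGraph

/-! ### Sampling functionals, compactness, and sine test spaces -/

namespace MetricGraph

variable {V : Type*} {G : SimpleGraph V} [Fintype G.edgeSet]

/-- Functions of the form space that vanish at equidistant points of every edge are small. -/
theorem exists_vanishing_functional (Γ : MetricGraph G) {n : ℕ} (hn : 0 < n) :
    ∃ Φ : Γ.FormSpace →L[ℝ] (Fin (Fintype.card G.edgeSet * n) → ℝ), ∀ x, Φ x = 0 →
      (n : ℝ) ^ 2 * ‖Γ.embed x‖ ^ 2 ≤ (∑ e, Γ.length e ^ 2) * ‖x.snd‖ ^ 2 := by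
  let σ : G.edgeSet × Fin n ≃ Fin (Fintype.card G.edgeSet * n) :=
    Fintype.equivFinOfCardEq (by simp)
  refine ⟨ContinuousLinearMap.pi fun i =>
    Γ.evalL (σ.symm i).1 (((σ.symm i).2 : ℕ) * (Γ.length (σ.symm i).1 / n)), fun x hx => ?_⟩
  have hn' : (0 : ℝ) < n := by exact_mod_cast hn
  have hzero : ∀ e, ∀ j < n, Γ.rep x e (j * (Γ.length e / n)) = 0 := by
    intro e j hj
    have h := congrFun hx (σ (e, ⟨j, hj⟩))
    simp only [ContinuousLinearMap.coe_pi', Equiv.symm_apply_apply, Pi.zero_apply] at h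
    rwa [evalL_apply] at h
    have hl := Γ.length_pos e
    refine ⟨by positivity, ?_⟩
    have hj' : (j : ℝ) ≤ n := by exact_mod_cast hj.le
    rw [mul_div_assoc', div_le_iff₀ hn', mul_comm]
    exact mul_le_mul_of_nonneg_left hj' hl.le
  have h1 : ‖Γ.embed x‖ ^ 2 = ∑ e, ∫ t in Ioo 0 (Γ.length e), Γ.rep x e t ^ 2 := by
    rw [← real_inner_self_eq_norm_sq, inner_embed_embed]
    simp only [sq]
  rw [h1, norm_sq_eq_sum, Finset.mul_sum, Finset.mul_sum]
  refine Finset.sum_le_sum fun e _ => ?_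
  refine ((Γ.isH1_rep x e).poincare (Γ.length_pos e) hn (hzero e)).trans ?_
  have h2 : 0 ≤ ∫ t in Ioo 0 (Γ.length e), x.snd e t ^ 2 := integral_nonneg fun t => sq_nonneg _
  gcongr
  exact Finset.single_le_sum (f := fun e => Γ.length e ^ 2) (fun e _ => sq_nonneg _)
    (Finset.mem_univ e)

/-- Vanishing at n points of every edge is a condition of finite codimension, under which the
embedding has norm at most √L / n, with L the sum of the squared lengths. -/
theorem isCompactOperator_embed (Γ : MetricGraph G) : IsCompactOperator Γ.embed := by
  refine isCompactOperator_of_small_on_finite_codim _ fun ε hε => ?_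
  set L := ∑ e, Γ.length e ^ 2
  have hL : 0 ≤ L := Finset.sum_nonneg fun e _ => sq_nonneg _
  obtain ⟨n, hn⟩ := exists_nat_gt (Real.sqrt L / ε)
  have hn0 : (0 : ℝ) < n := lt_of_le_of_lt (by positivity) hn
  obtain ⟨Φ, hΦ⟩ := Γ.exists_vanishing_functional (n := n) (by exact_mod_cast hn0)
  refine ⟨_, Φ, fun x hx => ?_⟩
  have h1 := hΦ x hx
  have h2 : ‖x.snd‖ ≤ ‖x‖ := WithLp.norm_snd_le _ x
  rw [div_lt_iff₀ hε] at hn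
  have h3 : L ≤ (n * ε) ^ 2 := (Real.sqrt_le_left (by positivity)).mp hn.le
  have h4 : (n : ℝ) ^ 2 * ‖Γ.embed x‖ ^ 2 ≤ n ^ 2 * (ε * ‖x‖) ^ 2 := by
    calc (n : ℝ) ^ 2 * ‖Γ.embed x‖ ^ 2 ≤ L * ‖x.snd‖ ^ 2 := h1
      _ ≤ (n * ε) ^ 2 * ‖x‖ ^ 2 := by gcongr
      _ = n ^ 2 * (ε * ‖x‖) ^ 2 := by ring
  have h5 := le_of_mul_le_mul_left h4 (by positivity)
  exact (sq_le_sq₀ (norm_nonneg _) (by positivity)).mp h5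

theorem norm_sum_smul_sq {H : Type*} [NormedAddCommGroup H] [InnerProductSpace ℝ H] {n : ℕ}
    {v : Fin n → H} {α : Fin n → ℝ} (hv : ∀ i j, inner ℝ (v i) (v j) = if i = j then α i else 0)
    (s : Fin n → ℝ) : ‖∑ i, s i • v i‖ ^ 2 = ∑ i, s i ^ 2 * α i := by
  rw [← real_inner_self_eq_norm_sq, sum_inner]
  refine Finset.sum_congr rfl fun i _ => ?_
  rw [inner_sum, Finset.sum_eq_single i]
  · rw [inner_smul_left, inner_smul_right, hv, if_pos rfl]
    simp only [conj_trivial]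
    ring
  · intro j _ hj
    rw [inner_smul_left, inner_smul_right, hv, if_neg hj.symm]
    simp
  · simp

/-- The sine functions on one edge form a test space with an inverse inequality. -/
theorem exists_test_space (Γ : MetricGraph G) (e : G.edgeSet) (n : ℕ) :
    ∃ b : (Fin n → ℝ) →ₗ[ℝ] Γ.FormSpace, (∀ s, b s ∈ Γ.formDomain) ∧
      (∀ s, Γ.embed (b s) = 0 → s = 0) ∧ ∀ s, ‖(b s).snd‖ ^ 2 ≤
        (Real.pi / Γ.length e) ^ 2 * (n : ℝ) ^ 2 * ‖Γ.embed (b s)‖ ^ 2 := by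
  have hl := Γ.length_pos e
  set l := Γ.length e with hl_def
  set κ : ℕ → ℝ := fun i => ((i : ℝ) + 1) * (Real.pi / l) with hκ
  have hH1 : ∀ i, IsH1 l (fun x => Real.sin (κ i * x)) (fun x => κ i * Real.cos (κ i * x)) :=
    fun i => isH1_sin l (κ i)
  let g : ∀ _ : ℕ, Lp ℝ 2 (volume.restrict (Ioo (0 : ℝ) l)) := fun i => (hH1 i).1.toLp
  have hg : ∀ i, g i =ᵐ[volume.restrict (Ioo (0 : ℝ) l)] fun x => κ i * Real.cos (κ i * x) :=
    fun i => (hH1 i).1.coeFn_toLp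
  have hprim : ∀ i, ∀ t ∈ Icc 0 l, ∫ s in (0 : ℝ)..t, g i s = Real.sin (κ i * t) := by
    intro i t ht
    rw [intervalIntegral_congr_of_ae (hg i) ht]
    have := (hH1 i).2 t ht
    simp only [mul_zero, Real.sin_zero, zero_add] at this
    exact this.symm
  have hend : ∀ i, ∫ s in (0 : ℝ)..l, g i s = 0 := by
    intro i
    rw [hprim i l (right_mem_Icc.mpr hl.le)]
    have : κ i * l = ((i + 1 : ℕ) : ℝ) * Real.pi := by
      simp only [κ]
      push_cast
      field_simp
    rw [this, Real.sin_nat_mul_pi]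
  -- `ψ i` is sin(κᵢ t) on e and zero elsewhere. Both the modes and their derivatives are
  -- orthogonal, so the two norms below are diagonal in the coefficients.
  let ψ : ℕ → Γ.FormSpace := fun i => Γ.edgeFun e (g i)
  have hJ : ∀ i j, inner ℝ (Γ.embed (ψ i)) (Γ.embed (ψ j)) = if i = j then l / 2 else 0 := by
    intro i j
    rw [inner_embed_embed, Finset.sum_eq_single e]
    · rw [← integral_sin_mul_sin hl]
      refine setIntegral_congr_fun measurableSet_Ioo fun t ht => ?_
      simp only [ψ]
      rw [rep_edgeFun_same, rep_edgeFun_same, hprim i t (Ioo_subset_Icc_self ht),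
        hprim j t (Ioo_subset_Icc_self ht)]
    · intro e' _ he'
      refine setIntegral_eq_zero_of_forall_eq_zero fun t ht => ?_
      simp only [ψ]
      rw [rep_edgeFun_of_ne Γ he' _ (Ioo_subset_Icc_self ht), zero_mul]
    · simp
  have hD : ∀ i j, inner ℝ (ψ i).snd (ψ j).snd =
      if i = j then κ i ^ 2 * (l / 2) else 0 := by
    intro i j
    rw [inner_eq_sum, Finset.sum_eq_single e]
    · have h1 : ∫ t in Ioo 0 (Γ.length e), (ψ i).snd e t *
          (ψ j).snd e t =
          ∫ t in Ioo 0 l, κ i * κ j * (Real.cos (κ i * t) * Real.cos (κ j * t)) := by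
        refine integral_congr_ae ?_
        filter_upwards [hg i, hg j] with t h1 h2
        simp only [ψ]
        rw [edgeFun_snd_same, edgeFun_snd_same, h1, h2]
        ring
      rw [h1, integral_const_mul, integral_cos_mul_cos hl]
      by_cases hij : i = j
      · subst hij
        simp [sq]
      · simp [hij]
    · intro e' _ he'
      refine integral_eq_zero_of_ae ?_
      filter_upwards [Lp.coeFn_zero ℝ 2 (volume.restrict (Ioo (0 : ℝ) (Γ.length e')))] with t ht
      simp only [ψ]
      rw [edgeFun_snd_of_ne Γ he', ht]
      simp
    · simp
  let b : (Fin n → ℝ) →ₗ[ℝ] Γ.FormSpace :=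
    Fintype.linearCombination ℝ (fun i : Fin n => ψ i)
  have hb : ∀ s, b s = ∑ i : Fin n, s i • ψ i := fun s => Fintype.linearCombination_apply ℝ _ _
  have hJs : ∀ s, ‖Γ.embed (b s)‖ ^ 2 = ∑ i : Fin n, s i ^ 2 * (l / 2) := by
    intro s
    rw [hb, map_sum]
    simp only [map_smul]
    refine norm_sum_smul_sq (fun i j => ?_) s
    rw [hJ]
    simp only [Fin.val_inj]
  have hDs : ∀ s, ‖(b s).snd‖ ^ 2 = ∑ i : Fin n, s i ^ 2 * (κ i ^ 2 * (l / 2)) := by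
    intro s
    have h1 : (b s).snd = ∑ i : Fin n, s i • (ψ i).snd := by
      have h2 := map_sum (WithLp.sndL 2 ℝ (EuclideanSpace ℝ G.edgeSet) Γ.StateSpace)
        (fun i : Fin n => s i • (ψ i : Γ.FormSpace)) Finset.univ
      rw [← hb] at h2
      simp only [map_smul] at h2
      exact h2
    rw [h1]
    refine norm_sum_smul_sq (v := fun i : Fin n => (ψ i).snd)
      (α := fun i : Fin n => κ i ^ 2 * (l / 2)) (fun i j => ?_) s
    rw [hD]
    simp only [Fin.val_inj]
  refine ⟨b, fun s => ?_, fun s hs => ?_, fun s => ?_⟩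
  · rw [hb]
    exact Submodule.sum_mem _ fun i _ =>
      Submodule.smul_mem _ _ (Γ.edgeFun_mem_formDomain (hend i))
  · have h1 := hJs s
    rw [hs] at h1
    simp only [norm_zero, ne_eq, OfNat.ofNat_ne_zero, not_false_eq_true, zero_pow] at h1
    have h2 := (Finset.sum_eq_zero_iff_of_nonneg (fun i _ => by positivity)).mp h1.symm
    funext i
    have h3 := h2 i (Finset.mem_univ _)
    have h4 : l / 2 ≠ 0 := by positivity
    simpa [h4] using h3
  · rw [hJs, hDs, Finset.mul_sum]
    refine Finset.sum_le_sum fun i _ => ?_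
    have hi : ((i : ℕ) : ℝ) + 1 ≤ n := by exact_mod_cast i.2
    have hκi : κ i ^ 2 ≤ (Real.pi / l) ^ 2 * (n : ℝ) ^ 2 := by
      simp only [κ]
      rw [mul_pow, mul_comm]
      gcongr
    calc s i ^ 2 * (κ i ^ 2 * (l / 2)) ≤ s i ^ 2 * ((Real.pi / l) ^ 2 * (n : ℝ) ^ 2 * (l / 2)) := by
          gcongr
      _ = (Real.pi / l) ^ 2 * (n : ℝ) ^ 2 * (s i ^ 2 * (l / 2)) := by ring

end MetricGraph

/-! ### Eigenvalue asymptotics -/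

/-- Needed because the flux is divided by c everywhere, end points included. Replacing the
inequality by the equation min(c₀, c) = c₀ lets continuity and density apply. -/
theorem le_of_ae_le_of_continuousOn {l : ℝ} (hl : 0 < l) {c : ℝ → ℝ} {c₀ : ℝ}
    (hc : ContinuousOn c (Icc 0 l))
    (h : ∀ᵐ x ∂(volume.restrict (Ioo 0 l)), c₀ ≤ c x) : ∀ t ∈ Icc 0 l, c₀ ≤ c t := by
  have hmin : ContinuousOn (fun t => min c₀ (c t)) (Icc 0 l) := continuousOn_const.inf hc
  have hEq : EqOn (fun t => min c₀ (c t)) (fun _ => c₀) (Ioo 0 l) := by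
    refine Measure.eqOn_open_of_ae_eq (μ := volume) ?_ isOpen_Ioo
      (hmin.mono Ioo_subset_Icc_self) continuousOn_const
    filter_upwards [h] with t ht
    exact min_eq_left ht
  have hEq' : EqOn (fun t => min c₀ (c t)) (fun _ => c₀) (Icc 0 l) := by
    refine hEq.of_subset_closure hmin continuousOn_const Ioo_subset_Icc_self ?_
    rw [closure_Ioo hl.ne]
  exact fun t ht => min_eq_left_iff.mp (hEq' ht)

theorem mainTheorem6 {V : Type*} [Fintype V] (G : SimpleGraph V) [Fintype G.edgeSet]
    [Nonempty G.edgeSet] (Γ : MetricGraph G) (c p : G.edgeSet → ℝ → ℝ)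
    (hc : ∀ e, ContinuousOn (c e) (Set.Icc 0 (Γ.length e)))
    (c₀ : ℝ) (hc₀ : 0 < c₀)
    (hcpos : ∀ e, ∀ᵐ x ∂(MeasureTheory.volume.restrict (Set.Ioo 0 (Γ.length e))), c₀ ≤ c e x)
    (hp : ∀ e, MeasureTheory.MemLp (p e) ⊤
      (MeasureTheory.volume.restrict (Set.Ioo 0 (Γ.length e))))
    (hpnonneg : ∀ e, ∀ᵐ x ∂(MeasureTheory.volume.restrict (Set.Ioo 0 (Γ.length e))), 0 ≤ p e x) :
    (∃ eig : ℕ → ℝ, Γ.IsEigenvalueSequence c p eig) ∧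
    ∀ eig : ℕ → ℝ, Γ.IsEigenvalueSequence c p eig →
      ∀ lam : ℝ, 0 < lam →
        ∃ l₁ l₂ : ℝ, 0 < l₁ ∧ 0 < l₂ ∧
          ∀ k : ℕ, l₁ * ((k : ℝ) + 1) ^ 2 ≤ lam - eig k ∧
            lam - eig k ≤ l₂ * ((k : ℝ) + 1) ^ 2 := by
  have hcne : ∀ e, ∀ t ∈ Icc 0 (Γ.length e), c e t ≠ 0 := fun e t ht =>
    (hc₀.trans_le (le_of_ae_le_of_continuousOn (Γ.length_pos e) (hc e) (hcpos e) t ht)).ne'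
  have hcm : ∀ e, MemLp (c e) ⊤ (volume.restrict (Ioo 0 (Γ.length e))) := by
    intro e
    obtain ⟨K, hK⟩ := isCompact_Icc.exists_bound_of_continuousOn (hc e)
    refine MemLp.of_bound
      (((hc e).mono Ioo_subset_Icc_self).aestronglyMeasurable measurableSet_Ioo) K ?_
    filter_upwards [ae_restrict_mem measurableSet_Ioo] with x hx
    exact hK x (Ioo_subset_Icc_self hx)
  let C : ∀ e : G.edgeSet, Lp ℝ ⊤ (volume.restrict (Ioo (0 : ℝ) (Γ.length e))) :=
    fun e => (hcm e).toLp
  let P : ∀ e : G.edgeSet, Lp ℝ ⊤ (volume.restrict (Ioo (0 : ℝ) (Γ.length e))) :=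
    fun e => (hp e).toLp
  have hC : ∀ e, C e =ᵐ[volume.restrict (Ioo 0 (Γ.length e))] c e := fun e => (hcm e).coeFn_toLp
  have hP : ∀ e, P e =ᵐ[volume.restrict (Ioo 0 (Γ.length e))] p e := fun e => (hp e).coeFn_toLp
  have hC0 : ∀ e, ∀ᵐ t ∂(volume.restrict (Ioo 0 (Γ.length e))), c₀ ≤ C e t := by
    intro e
    filter_upwards [hC e, hcpos e] with t h1 h2
    rwa [h1]
  have hP0 : ∀ e, ∀ᵐ t ∂(volume.restrict (Ioo 0 (Γ.length e))), 0 ≤ P e t := by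
    intro e
    filter_upwards [hP e, hpnonneg e] with t h1 h2
    rwa [h1]
  set J := Γ.embed
  set a := Γ.form C P
  have hrel : ∀ f h, Γ.OperatorRel c p f h ↔ WeakRelOn a J Γ.formDomain f h := by
    intro f h
    constructor
    · exact fun H => Γ.exists_form_of_operatorRel hC hP H
    · rintro ⟨x, hx, rfl, hy⟩
      exact Γ.operatorRel_of_form hC hP hcne hx hy
  have hsymm : ∀ x y, a x y = a y x := fun x y => Γ.form_symm C P x y
  have hlow : ∀ x : Γ.FormSpace, c₀ * ‖x.snd‖ ^ 2 ≤ a x x := fun x => Γ.le_form C P hC0 hP0 x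
  have hpos : ∀ x, 0 ≤ a x x := fun x => le_trans (by positivity) (hlow x)
  obtain ⟨e₀⟩ := ‹Nonempty G.edgeSet›
  obtain ⟨K, hK, hKa⟩ := Γ.form_le C P
  have htest : ∀ n : ℕ, 0 < n → ∃ b : (Fin n → ℝ) →ₗ[ℝ] Γ.FormSpace,
      (∀ s, b s ∈ Γ.formDomain) ∧ (∀ s, J (b s) = 0 → s = 0) ∧ ∀ s, a (b s) (b s) ≤
        K * ((Real.pi / Γ.length e₀) ^ 2 + 1) * (n : ℝ) ^ 2 * ‖J (b s)‖ ^ 2 := by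
    intro n hn
    obtain ⟨b, hbK, hb, hbn⟩ := Γ.exists_test_space e₀ n
    refine ⟨b, hbK, hb, fun s => (hKa _).trans ?_⟩
    -- Since n ≥ 1, the zero-order part of the form is absorbed in n²; this is the summand 1 in the
    -- constant.
    have hn1 : (1 : ℝ) ≤ (n : ℝ) ^ 2 := one_le_pow₀ (by exact_mod_cast hn)
    have h1 : ‖Γ.embed (b s)‖ ^ 2 ≤ (n : ℝ) ^ 2 * ‖Γ.embed (b s)‖ ^ 2 :=
      le_mul_of_one_le_left (sq_nonneg _) hn1
    have h2 := hbn s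
    rw [mul_assoc, mul_assoc]
    refine mul_le_mul_of_nonneg_left ?_ hK
    linarith
  have hinf : ¬ FiniteDimensional ℝ Γ.StateSpace := by
    refine not_finiteDimensional_of_test J fun n hn => ?_
    obtain ⟨b, -, hb, -⟩ := htest n hn
    exact ⟨b, hb⟩
  constructor
  · have hcoer : ∃ δ > 0, ∀ x, δ * ‖x‖ * ‖x‖ ≤ a x x + inner ℝ (J x) (J x) := by
      obtain ⟨M, hM, hMx⟩ := Γ.exists_norm_le
      -- The factor 2 M² comes from squaring the bound `hMx`; `min c₀ 1` is the smaller of the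
      -- weights of `‖x.snd‖ ^ 2` and `‖J x‖ ^ 2`.
      refine ⟨min c₀ 1 / (2 * M ^ 2), by positivity, fun x => ?_⟩
      rw [real_inner_self_eq_norm_sq]
      have h1 : ‖x‖ ≤ M * (‖x.snd‖ + ‖J x‖) := hMx x
      have h2 : ‖x‖ * ‖x‖ ≤ M ^ 2 * (2 * (‖x.snd‖ ^ 2 + ‖J x‖ ^ 2)) := by
        calc ‖x‖ * ‖x‖ ≤ (M * (‖x.snd‖ + ‖J x‖)) *
              (M * (‖x.snd‖ + ‖J x‖)) := by gcongr
          _ = M ^ 2 * (‖x.snd‖ + ‖J x‖) ^ 2 := by ring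
          _ ≤ _ := by
            gcongr
            exact add_sq_le
      calc min c₀ 1 / (2 * M ^ 2) * ‖x‖ * ‖x‖
          ≤ min c₀ 1 / (2 * M ^ 2) *
            (M ^ 2 * (2 * (‖x.snd‖ ^ 2 + ‖J x‖ ^ 2))) := by
            rw [mul_assoc]
            gcongr
        _ = min c₀ 1 * ‖x.snd‖ ^ 2 + min c₀ 1 * ‖J x‖ ^ 2 := by
            field_simp
        _ ≤ c₀ * ‖x.snd‖ ^ 2 + 1 * ‖J x‖ ^ 2 := by
            gcongr
            · exact min_le_left _ _
            · exact min_le_right _ _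
        _ ≤ a x x + ‖J x‖ ^ 2 := by linarith [hlow x]
    have hsing : ∀ h, WeakRelOn a J Γ.formDomain 0 h → h = 0 := fun h hh =>
      Γ.operatorRel_unique c p ((hrel 0 h).mpr hh) (Γ.operatorGraph c p).zero_mem
    obtain ⟨f, eig, heig, hf⟩ := exists_weak_eigenbasis_on hinf Γ.isClosed_formDomain hsymm
      hcoer Γ.isCompactOperator_embed hsing
    refine ⟨eig, heig, f, fun k => ?_⟩
    have h1 := (Γ.mem_operator_graph_iff c p _ _).mpr ((hrel _ _).mpr (hf k))
    rw [LinearPMap.mem_graph_iff] at h1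
    obtain ⟨y, hy1, hy2⟩ := h1
    have hk : f k ∈ (Γ.operator c p).domain := by
      have h2 := y.2
      rwa [hy1] at h2
    refine ⟨hk, ?_⟩
    have hy : y = ⟨f k, hk⟩ := Subtype.ext hy1
    rw [← hy]
    exact hy2
  · rintro eig ⟨heig, f, hf⟩ lam hlam
    have hw : ∀ k, WeakRelOn a J Γ.formDomain (f k) (eig k • f k) := by
      intro k
      obtain ⟨hk, hk'⟩ := hf k
      rw [← hrel, ← Γ.mem_operator_graph_iff, ← hk']
      exact (Γ.operator c p).mem_graph ⟨f k, hk⟩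
    set L := ∑ e, Γ.length e ^ 2
    have hL : 0 < L := Finset.sum_pos (fun e _ => pow_pos (Γ.length_pos e) 2) ⟨e₀, Finset.mem_univ _⟩
    have happ : ∀ n : ℕ, 0 < n → ∃ Φ : Γ.FormSpace →ₗ[ℝ] (Fin (Fintype.card G.edgeSet * n) → ℝ),
        ∀ x, Φ x = 0 → (n : ℝ) ^ 2 * ‖J x‖ ^ 2 ≤ L / c₀ * a x x := by
      intro n hn
      obtain ⟨Φ, hΦ⟩ := Γ.exists_vanishing_functional hn
      refine ⟨Φ, fun x hx => ?_⟩
      refine (hΦ x hx).trans ?_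
      rw [div_mul_eq_mul_div, le_div_iff₀ hc₀, mul_assoc]
      refine mul_le_mul_of_nonneg_left ?_ hL.le
      rw [mul_comm]
      exact hlow x
    obtain ⟨l₁, hl₁, h₁⟩ := exists_quadratic_lower_bound_on f.orthonormal heig hw hpos
      (Fintype.card_pos_iff.mpr ⟨e₀⟩) (div_pos hL hc₀) happ hlam
    obtain ⟨l₂, hl₂, h₂⟩ := exists_quadratic_upper_bound_on f heig hw hpos hsymm
      (by positivity) htest hlam
    exact ⟨l₁, l₂, hl₁, hl₂, fun k => ⟨h₁ k, h₂ k⟩⟩
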